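/- Let $R$ be a ring (for $R=\mathbb{Z}$, $R$-modules are abelian groups). Let $\{X_i,\varphi_{ij}\}_{i\in I}$ be an inverse system of compact Hausdorff spaces, indexed by a nonempty directed set $I$, whose maps $\varphi_{ij}:X_j\to X_i$ ($i\preceq j$) are all surjective, and let $X=\varprojlim X_i$ with projections $\varphi_i:X\to X_i$. For a presheaf $\Gamma$ and a continuous map $\varphi$, let $\varphi\Gamma$ denote the pushforward, $\varphi\Gamma(U)=\Gamma(\varphi^{-1}(U))$. Let $\{\Gamma_i\}_{i\in I}$ be a system of sheaves of $R$-modules: a sheaf $\Gamma_i$ on each $X_i$ and injective maps of presheaves $f_{ij}:\Gamma_i\to\varphi_{ij}\Gamma_j$ for $i\preceq j$, with $f_{ii}=\mathrm{id}$ and $f_{jk}f_{ij}=f_{ik}$ for $i\preceq j\preceq k$. Let $\mathcal{B}=\{\varphi_i^{-1}(U): i\in I,\ U\subset X_i \text{ open}\}$ be the standard basis of $X$. A limiting partial presheaf of the system is a presheaf $\Gamma$ of $R$-modules on $\mathcal{B}$ with maps of presheaves $f_i:\Gamma_i\to\varphi_i\Gamma$ such that $f_jf_{ij}=f_i$ for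 $i\preceq j$ and such that, for each $i$, $\varphi_i\Gamma=\varinjlim_{j\succeq i}\varphi_{ij}\Gamma_j$ with canonical maps $f_j:\varphi_{ij}\Gamma_j\to\varphi_i\Gamma$. For a presheaf $\Gamma$ on a basis $\mathcal{B}$ (closed under intersections of two members), let $\Gamma^{+}$ be the presheaf on $X$ with $\Gamma^{+}(W)=\varinjlim_{\mathscr{U}}\Gamma(\mathscr{U})$, where $\mathscr{U}$ runs over the covers of $W$ by members of $\mathcal{B}$, ordered by refinement, and $\Gamma(\mathscr{U})$ is the module of families $\{\gamma_U\in\Gamma(U)\}_{U\in\mathscr{U}}$ with $\gamma_U|_{U\cap V}=\gamma_V|_{U\cap V}$; let $\alpha:\Gamma\to\Gamma^+$ be the natural map, and let $\hat\Gamma=\Gamma^{++}$ be the sheafification. Let $\check H^n(X,\Gamma)=\varinjlim_{\mathscr{U}}\check H^n(\mathscr{U},\Gamma)$ be Čech cohomology, where $\mathscr{U}$ runs over the open covers of $X$ by members of $\mathcal{B}$ (of all open covers, if $\Gamma$ is a presheaf on $X$) and $\check H^n(\mathscr{U},\Gamma)$ is computed from the cochains $f(U_0,\dots,U_n)\in\Gamma(U_0\cap\dots\cap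 U_n)$. Then a limiting partial presheaf of the system exists; and for every limiting partial presheaf $\Gamma$, with limiting sheaf $\hat\Gamma$, and every $n\ge 0$, the homomorphism $$\varinjlim_{i\in I}\check H^n(X_i,\Gamma_i)\longrightarrow\check H^n(X,\hat\Gamma)$$ is an isomorphism of $R$-modules. Here the direct system on the left is given by the homomorphisms induced by $\varphi_{ij}$ and $f_{ij}$, and the homomorphism is induced by the composites $\check H^n(X_i,\Gamma_i)\to\check H^n(X,\Gamma)\to\check H^n(X,\hat\Gamma)$ of the homomorphism induced by $\varphi_i$ and $f_i$ with the one induced by $\alpha$ applied twice. -/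

import Mathlib

open CategoryTheory CategoryTheory.Limits TopologicalSpace Opposite

universe u v

noncomputable section

namespace CechContinuity

/-! ## Presheaves on a basis of open sets -/

/-- A basis of the topology of `X` which is closed under intersections of two members. -/
structure OpenBasis (X : TopCat.{u}) where
  carrier : Set (Opens X)
  isBasis : Opens.IsBasis carrier
  inf_mem : ∀ U ∈ carrier, ∀ V ∈ carrier, U ⊓ V ∈ carrier

/-- The basis consisting of all open subsets. -/
def OpenBasis.all (X : TopCat.{u}) : OpenBasis X where
  carrier := Set.univ
  isBasis := Opens.isBasis_iff_nbhd.2 fun {U} _ hx => ⟨U, trivial, hx, le_rfl⟩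
  inf_mem _ _ _ _ := trivial

variable {R : Type v} [Ring R]

/-- A presheaf of `R`-modules on the basis `B`, i.e. a contravariant functor on the poset `B`
of open sets ordered by inclusion. -/
abbrev BasisPresheaf (R : Type v) [Ring R] {X : TopCat.{u}} (B : OpenBasis X) :=
  (B.carrier)ᵒᵖ ⥤ ModuleCat.{u} R

/-- The restriction map `Γ(U) → Γ(V)` for `V ⊆ U` in `B`. -/
def BasisPresheaf.res {X : TopCat.{u}} {B : OpenBasis X} (Γ : BasisPresheaf R B)
    {U V : B.carrier} (h : V ≤ U) : Γ.obj (op U) ⟶ Γ.obj (op V) :=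
  Γ.map (homOfLE h).op

theorem BasisPresheaf.res_res {X : TopCat.{u}} {B : OpenBasis X} (Γ : BasisPresheaf R B)
    {U V W : B.carrier} (h : V ≤ U) (h' : W ≤ V) (x : Γ.obj (op U)) :
    Γ.res h' (Γ.res h x) = Γ.res (h'.trans h) x := by
  simp only [BasisPresheaf.res, ← ConcreteCategory.comp_apply, ← Γ.map_comp]
  rfl

theorem BasisPresheaf.res_self {X : TopCat.{u}} {B : OpenBasis X} (Γ : BasisPresheaf R B)
    {U : B.carrier} (h : U ≤ U) (x : Γ.obj (op U)) : Γ.res h x = x := by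
  have : (homOfLE h).op = 𝟙 (op U) := rfl
  simp only [BasisPresheaf.res, this, Γ.map_id, ConcreteCategory.id_apply]

/-- The restriction `Γ_B` of a presheaf `Γ` on `X` to the basis `B`. -/
def restrictToBasis {X : TopCat.{u}} (Γ : TopCat.Presheaf (ModuleCat.{u} R) X)
    (B : OpenBasis X) : BasisPresheaf R B :=
  (Subtype.mono_coe (· ∈ B.carrier)).functor.op ⋙ Γ

/-! ## Covers -/

/-- An open cover of the open set `W` by members of the basis `B`. -/
structure Cover {X : TopCat.{u}} (B : OpenBasis X) (W : Opens X) where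
  carrier : Set (Opens X)
  subset : carrier ⊆ B.carrier
  sSup_eq : sSup carrier = W

/-- Covers are preordered by refinement: `𝓤 ≤ 𝓥` if every member of `𝓥` is contained in
some member of `𝓤`. -/
instance {X : TopCat.{u}} (B : OpenBasis X) (W : Opens X) : Preorder (Cover B W) where
  le 𝓤 𝓥 := ∀ V ∈ 𝓥.carrier, ∃ U ∈ 𝓤.carrier, V ≤ U
  le_refl _ V hV := ⟨V, hV, le_rfl⟩
  le_trans _ _ _ h h' W hW :=
    let ⟨V, hV, hWV⟩ := h' W hW
    let ⟨U, hU, hVU⟩ := h V hV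
    ⟨U, hU, hWV.trans hVU⟩

/-- A member of a cover, as a member of the basis. -/
abbrev Cover.toBasis {X : TopCat.{u}} {B : OpenBasis X} {W : Opens X} (𝓤 : Cover B W)
    (U : 𝓤.carrier) : B.carrier :=
  ⟨U.1, 𝓤.subset U.2⟩

/-- For a cover `𝓤` of `W` and `W' ⊆ W`, the cover of `W'` by all `U' ∈ B` contained in
`U ∩ W'` for some `U ∈ 𝓤`. -/
def Cover.restrict {X : TopCat.{u}} {B : OpenBasis X} {W W' : Opens X} (𝓤 : Cover B W)
    (h : W' ≤ W) : Cover B W' where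
  carrier := {U' | U' ∈ B.carrier ∧ ∃ U ∈ 𝓤.carrier, U' ≤ U ⊓ W'}
  subset _ hU := hU.1
  sSup_eq := by
    apply le_antisymm
    · exact sSup_le fun U' ⟨_, U, _, hU'⟩ => hU'.trans inf_le_right
    · intro x hx
      have hxW : x ∈ sSup 𝓤.carrier := by rw [𝓤.sSup_eq]; exact h hx
      obtain ⟨U, hU, hxU⟩ := Opens.mem_sSup.1 hxW
      obtain ⟨U', hU', hxU', hle⟩ :=
        Opens.isBasis_iff_nbhd.1 B.isBasis (U := U ⊓ W') (x := x) ⟨hxU, hx⟩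
      exact Opens.mem_sSup.2 ⟨U', ⟨hU', U, hU, hle⟩, hxU'⟩

/-- The cover `{V}` of `V`. -/
def Cover.single {X : TopCat.{u}} {B : OpenBasis X} (V : B.carrier) : Cover B V.1 where
  carrier := {V.1}
  subset := by rintro _ rfl; exact V.2
  sSup_eq := sSup_singleton

/-! ## Compatible families and the `+` construction -/

section Plus

variable {X : TopCat.{u}} {B : OpenBasis X} (Γ : BasisPresheaf R B)

/-- The intersection of two members of the basis. -/
abbrev OpenBasis.inf (U V : B.carrier) : B.carrier :=
  ⟨U.1 ⊓ V.1, B.inf_mem _ U.2 _ V.2⟩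

/-- The module `Γ(𝓤)` of compatible `𝓤`-families of `Γ`. -/
def compatibleFamilies {W : Opens X} (𝓤 : Cover B W) :
    Submodule R (∀ U : 𝓤.carrier, Γ.obj (op (𝓤.toBasis U))) where
  carrier := {γ | ∀ U V : 𝓤.carrier,
    Γ.res (V := OpenBasis.inf (𝓤.toBasis U) (𝓤.toBasis V)) (Subtype.mk_le_mk.2 inf_le_left) (γ U) =
    Γ.res (V := OpenBasis.inf (𝓤.toBasis U) (𝓤.toBasis V)) (Subtype.mk_le_mk.2 inf_le_right) (γ V)}
  add_mem' ha hb U V := by simp [ha U V, hb U V]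
  zero_mem' U V := by simp
  smul_mem' r a ha U V := by simp [ha U V]

variable {Γ}

theorem compatibleFamilies_res_eq {W : Opens X} {𝓤 : Cover B W}
    (γ : compatibleFamilies Γ 𝓤) (U V : 𝓤.carrier) (T : B.carrier)
    (hU : T ≤ 𝓤.toBasis U) (hV : T ≤ 𝓤.toBasis V) :
    Γ.res hU (γ.1 U) = Γ.res hV (γ.1 V) := by
  have hT : T ≤ OpenBasis.inf (𝓤.toBasis U) (𝓤.toBasis V) := le_inf (α := Opens X) hU hV
  have := congrArg (Γ.res hT) (γ.2 U V)
  exact (Γ.res_res _ hT _).symm.trans (this.trans (Γ.res_res _ hT _))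

variable (Γ)

/-- For a function `l : 𝓥 → 𝓤` with `V ⊆ l(V)`, the homomorphism `Γ(𝓤) → Γ(𝓥)` which sends
`γ` to the family `γ_{l(V)}|V`. -/
def refineFamiliesAlong {W W' : Opens X} {𝓤 : Cover B W} {𝓥 : Cover B W'}
    (l : 𝓥.carrier → 𝓤.carrier) (hl : ∀ V, 𝓥.toBasis V ≤ 𝓤.toBasis (l V)) :
    compatibleFamilies Γ 𝓤 →ₗ[R] compatibleFamilies Γ 𝓥 :=
  LinearMap.codRestrict _
    (LinearMap.pi fun V => (Γ.res (hl V)).hom ∘ₗ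
      (LinearMap.proj (φ := fun U => Γ.obj (op (𝓤.toBasis U))) (l V)) ∘ₗ Submodule.subtype _)
    fun γ V V' =>
      (Γ.res_res (hl V) (Subtype.mk_le_mk.2 inf_le_left) (γ.1 (l V))).trans
        ((compatibleFamilies_res_eq γ (l V) (l V') (OpenBasis.inf (𝓥.toBasis V) (𝓥.toBasis V'))
          _ _).trans
          (Γ.res_res (hl V') (Subtype.mk_le_mk.2 inf_le_right) (γ.1 (l V'))).symm)

/-- If every member of the cover `𝓥` is contained in a member of the cover `𝓤`, this is the
homomorphism `Γ(𝓤) → Γ(𝓥)` with `γ_V = γ_U|V` whenever `V ⊆ U`. -/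
def refineFamilies {W W' : Opens X} (𝓤 : Cover B W) (𝓥 : Cover B W')
    (h : ∀ V ∈ 𝓥.carrier, ∃ U ∈ 𝓤.carrier, V ≤ U) :
    ModuleCat.of R (compatibleFamilies Γ 𝓤) ⟶ ModuleCat.of R (compatibleFamilies Γ 𝓥) :=
  ModuleCat.ofHom (refineFamiliesAlong Γ
    (fun V => ⟨(h V.1 V.2).choose, (h V.1 V.2).choose_spec.1⟩)
    (fun V => (h V.1 V.2).choose_spec.2))

theorem refineFamilies_apply {W W' : Opens X} {𝓤 : Cover B W} {𝓥 : Cover B W'}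
    (h : ∀ V ∈ 𝓥.carrier, ∃ U ∈ 𝓤.carrier, V ≤ U) (γ : compatibleFamilies Γ 𝓤)
    (V : 𝓥.carrier) (U : 𝓤.carrier) (hVU : 𝓥.toBasis V ≤ 𝓤.toBasis U) :
    ((refineFamilies Γ 𝓤 𝓥 h).hom γ).1 V = Γ.res hVU (γ.1 U) :=
  compatibleFamilies_res_eq γ ⟨_, (h V.1 V.2).choose_spec.1⟩ U (𝓥.toBasis V)
    (h V.1 V.2).choose_spec.2 hVU

theorem families_hom_ext {M : ModuleCat.{u} R} {W : Opens X} {𝓤 : Cover B W}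
    {f g : M ⟶ ModuleCat.of R (compatibleFamilies Γ 𝓤)}
    (h : ∀ x U, (f.hom x).1 U = (g.hom x).1 U) : f = g :=
  ModuleCat.hom_ext (LinearMap.ext fun x => Subtype.ext (funext (h x)))

theorem refineFamilies_comp {W W' W'' : Opens X} {𝓤 : Cover B W} {𝓥 : Cover B W'}
    {𝓦 : Cover B W''} (h : ∀ V ∈ 𝓥.carrier, ∃ U ∈ 𝓤.carrier, V ≤ U)
    (h' : ∀ V ∈ 𝓦.carrier, ∃ U ∈ 𝓥.carrier, V ≤ U)
    (h'' : ∀ V ∈ 𝓦.carrier, ∃ U ∈ 𝓤.carrier, V ≤ U) :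
    refineFamilies Γ 𝓤 𝓥 h ≫ refineFamilies Γ 𝓥 𝓦 h' = refineFamilies Γ 𝓤 𝓦 h'' := by
  refine families_hom_ext Γ fun γ T => ?_
  obtain ⟨V, hV, hTV⟩ := h' T.1 T.2
  obtain ⟨U, hU, hVU⟩ := h V hV
  refine (refineFamilies_apply Γ h' _ T ⟨V, hV⟩ hTV).trans ?_
  refine (congrArg _ (refineFamilies_apply Γ h γ ⟨V, hV⟩ ⟨U, hU⟩ hVU)).trans ?_
  refine (Γ.res_res _ _ _).trans ?_
  exact (refineFamilies_apply Γ h'' γ T ⟨U, hU⟩ (hTV.trans hVU)).symm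

theorem refineFamilies_self {W : Opens X} {𝓤 : Cover B W}
    (h : ∀ V ∈ 𝓤.carrier, ∃ U ∈ 𝓤.carrier, V ≤ U) :
    refineFamilies Γ 𝓤 𝓤 h = 𝟙 _ :=
  families_hom_ext Γ fun γ T =>
    (refineFamilies_apply Γ h γ T T le_rfl).trans (Γ.res_self _ _)

/-- The direct system of the modules `Γ(𝓤)`, for `𝓤` a cover of `W` by members of `B`. -/
def familiesFunctor (W : Opens X) : Cover B W ⥤ ModuleCat.{u} R where
  obj 𝓤 := ModuleCat.of R (compatibleFamilies Γ 𝓤)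
  map f := refineFamilies Γ _ _ (leOfHom f)
  map_id _ := refineFamilies_self Γ _
  map_comp _ _ := (refineFamilies_comp Γ _ _ _).symm

/-- The module `Γ⁺(W)`: the direct limit of the modules `Γ(𝓤)` of compatible families, over
the covers `𝓤` of `W` by members of `B`. -/
def plusObj (W : Opens X) : ModuleCat.{u} R := colimit (familiesFunctor Γ W)

/-- The canonical map `Γ(𝓤) → Γ⁺(W)`. -/
def plusι {W : Opens X} (𝓤 : Cover B W) :
    ModuleCat.of R (compatibleFamilies Γ 𝓤) ⟶ plusObj Γ W :=
  colimit.ι (familiesFunctor Γ W) 𝓤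

theorem plus_w {W : Opens X} {𝓤 𝓥 : Cover B W} (h : 𝓤 ≤ 𝓥) :
    refineFamilies Γ 𝓤 𝓥 h ≫ plusι Γ 𝓥 = plusι Γ 𝓤 :=
  colimit.w (familiesFunctor Γ W) (homOfLE h)

theorem plus_hom_ext {W : Opens X} {M : ModuleCat.{u} R} {f g : plusObj Γ W ⟶ M}
    (h : ∀ 𝓤, plusι Γ 𝓤 ≫ f = plusι Γ 𝓤 ≫ g) : f = g :=
  colimit.hom_ext h

theorem Cover.restrict_refines {W W' : Opens X} (𝓤 : Cover B W) (h : W' ≤ W) :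
    ∀ V ∈ (𝓤.restrict h).carrier, ∃ U ∈ 𝓤.carrier, V ≤ U :=
  fun _ ⟨_, U, hU, hVU⟩ => ⟨U, hU, hVU.trans inf_le_left⟩

theorem Cover.restrict_le {W W' : Opens X} {𝓤 : Cover B W} {𝓥 : Cover B W'} (h : W' ≤ W)
    (h𝓥 : ∀ V ∈ 𝓥.carrier, ∃ U ∈ 𝓤.carrier, V ≤ U) : 𝓤.restrict h ≤ 𝓥 := fun V hV =>
  have ⟨U, hU, hVU⟩ := h𝓥 V hV
  ⟨V, ⟨𝓥.subset hV, U, hU, le_inf hVU ((le_sSup hV).trans 𝓥.sSup_eq.le)⟩, le_rfl⟩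

theorem Cover.refines_trans {W W' W'' : Opens X} {𝓤 : Cover B W} {𝓥 : Cover B W'}
    {𝓦 : Cover B W''} (h : ∀ V ∈ 𝓥.carrier, ∃ U ∈ 𝓤.carrier, V ≤ U)
    (h' : ∀ V ∈ 𝓦.carrier, ∃ U ∈ 𝓥.carrier, V ≤ U) :
    ∀ V ∈ 𝓦.carrier, ∃ U ∈ 𝓤.carrier, V ≤ U := fun W hW =>
  have ⟨V, hV, hWV⟩ := h' W hW
  have ⟨U, hU, hVU⟩ := h V hV
  ⟨U, hU, hWV.trans hVU⟩

/-- The restriction map `Γ⁺(W) → Γ⁺(W')` for `W' ⊆ W`, induced by the homomorphisms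
`Γ(𝓤) → Γ(𝓤')` where `𝓤'` consists of the `U' ∈ B` contained in some `U ∩ W'`, `U ∈ 𝓤`. -/
def plusRes {W W' : Opens X} (h : W' ≤ W) : plusObj Γ W ⟶ plusObj Γ W' :=
  colimit.desc (familiesFunctor Γ W)
    { pt := plusObj Γ W'
      ι :=
        { app := fun 𝓤 =>
            refineFamilies Γ 𝓤 (𝓤.restrict h) (𝓤.restrict_refines h) ≫ plusι Γ (𝓤.restrict h)
          naturality := fun 𝓤 𝓥 f => by
            have h₁ := Cover.refines_trans (leOfHom f) (𝓥.restrict_refines h)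
            refine Eq.trans ?_ (Category.comp_id _).symm
            refine (Category.assoc (refineFamilies Γ 𝓤 𝓥 (leOfHom f)) _ _).symm.trans ?_
            rw [refineFamilies_comp Γ _ _ h₁, ← plus_w Γ (Cover.restrict_le h h₁)]
            exact (congrArg (· ≫ plusι Γ _) (refineFamilies_comp Γ (𝓤.restrict_refines h)
              (Cover.restrict_le h h₁) h₁).symm).trans (Category.assoc _ _ _) } }

theorem plusι_plusRes {W W' : Opens X} (h : W' ≤ W) (𝓤 : Cover B W) (𝓥 : Cover B W')
    (h𝓥 : ∀ V ∈ 𝓥.carrier, ∃ U ∈ 𝓤.carrier, V ≤ U) :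
    plusι Γ 𝓤 ≫ plusRes Γ h = refineFamilies Γ 𝓤 𝓥 h𝓥 ≫ plusι Γ 𝓥 := by
  refine (colimit.ι_desc _ _).trans ?_
  change refineFamilies Γ _ _ _ ≫ _ = _
  rw [← plus_w Γ (Cover.restrict_le h h𝓥), ← Category.assoc, refineFamilies_comp]

/-- The presheaf `Γ⁺` on `X`. -/
def plus : TopCat.Presheaf (ModuleCat.{u} R) X where
  obj W := plusObj Γ W.unop
  map f := plusRes Γ (leOfHom f.unop)
  map_id W := by
    refine plus_hom_ext Γ fun 𝓤 => ?_
    rw [plusι_plusRes Γ _ 𝓤 𝓤 (le_refl 𝓤), refineFamilies_self, Category.id_comp,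
      Category.comp_id]
  map_comp {W W' W''} f g := by
    refine plus_hom_ext Γ fun 𝓤 => ?_
    have h₁ := 𝓤.restrict_refines (leOfHom f.unop)
    have h₂ := (𝓤.restrict (leOfHom f.unop)).restrict_refines (leOfHom g.unop)
    rw [plusι_plusRes Γ _ 𝓤 _ (Cover.refines_trans h₁ h₂), ← Category.assoc,
      plusι_plusRes Γ _ 𝓤 _ h₁, Category.assoc, plusι_plusRes Γ _ _ _ h₂, ← Category.assoc,
      refineFamilies_comp]

/-- The compatible family `{γ}` for the cover `{V}` of `V`, where `γ ∈ Γ(V)`. -/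
def singleFamily (V : B.carrier) :
    Γ.obj (op V) ⟶ ModuleCat.of R (compatibleFamilies Γ (Cover.single V)) :=
  ModuleCat.ofHom (LinearMap.codRestrict _
    (LinearMap.pi fun U => (Γ.res (Subtype.mk_le_mk.2 (le_of_eq U.2) :
      (Cover.single V).toBasis U ≤ V)).hom)
    fun γ U U' => (Γ.res_res (Subtype.mk_le_mk.2 (le_of_eq U.2))
        (Subtype.mk_le_mk.2 inf_le_left) γ).trans
      (Γ.res_res (Subtype.mk_le_mk.2 (le_of_eq U'.2)) (Subtype.mk_le_mk.2 inf_le_right) γ).symm)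

/-- The natural map `α : Γ → (Γ⁺)_B`, sending `γ ∈ Γ(V)` to the class of the compatible
family `{γ}` for the cover `{V}` of `V`. -/
def toPlus : Γ ⟶ restrictToBasis (plus Γ) B where
  app V := singleFamily Γ V.unop ≫ plusι Γ (Cover.single V.unop)
  naturality V V' f := by
    have h : ∀ T ∈ (Cover.single V'.unop).carrier, ∃ U ∈ (Cover.single V.unop).carrier, T ≤ U := by
      rintro _ rfl
      exact ⟨_, rfl, leOfHom f.unop⟩
    have key : Γ.res (leOfHom f.unop) ≫ singleFamily Γ V'.unop =
        singleFamily Γ V.unop ≫ refineFamilies Γ _ _ h := ?_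
    · change Γ.res (leOfHom f.unop) ≫ singleFamily Γ V'.unop ≫ plusι Γ _ =
        (singleFamily Γ V.unop ≫ plusι Γ _) ≫ plusRes Γ (leOfHom f.unop)
      refine (Category.assoc _ _ _).symm.trans ?_
      rw [key]
      refine ((Category.assoc _ _ _).trans ?_).trans (Category.assoc _ _ _).symm
      rw [plusι_plusRes Γ _ _ _ h]
    refine families_hom_ext Γ fun γ T => ?_
    obtain ⟨_, rfl⟩ := T
    refine Eq.trans ?_ (refineFamilies_apply Γ h _ ⟨_, rfl⟩ ⟨_, rfl⟩ (leOfHom f.unop)).symm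
    exact (Γ.res_res (leOfHom f.unop) le_rfl γ).trans (Γ.res_res le_rfl (leOfHom f.unop) γ).symm

/-- The sheafification `Γ⁺⁺` of a presheaf `Γ` on the basis `B`; in the second step the basis
is that of all open subsets. -/
def sheafification : TopCat.Presheaf (ModuleCat.{u} R) X :=
  plus (restrictToBasis (plus Γ) (OpenBasis.all X))

end Plus

/-! ## Čech cohomology of a space with a presheaf on a basis -/

/-- A topological space together with a basis and a presheaf of `R`-modules on that basis. -/
structure CechPair (R : Type v) [Ring R] where
  space : TopCat.{u}
  basis : OpenBasis space
  presheaf : BasisPresheaf R basis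

/-- For a continuous map `φ : X ⟶ Y` such that preimages of members of `B'` belong to `B`, the
monotone map `U ↦ φ⁻¹(U)` as a functor `B' ⥤ B`. -/
def preimageFunctor {X Y : TopCat.{u}} (φ : X ⟶ Y) (B : OpenBasis X) (B' : OpenBasis Y)
    (h : ∀ U ∈ B'.carrier, (Opens.map φ).obj U ∈ B.carrier) : B'.carrier ⥤ B.carrier where
  obj U := ⟨(Opens.map φ).obj U.1, h U.1 U.2⟩
  map f := homOfLE (show (Opens.map φ).obj _ ≤ (Opens.map φ).obj _ from
    ((Opens.map φ).map (homOfLE (leOfHom f))).le)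

/-- The data which induce homomorphisms from the Čech cohomology of `Q` to that of `P`: a
continuous map `φ` from the space of `P` to the space of `Q`, pulling back the basis of `Q` into
that of `P`, and a map of presheaves from the presheaf of `Q` to the pushforward along `φ` of
the presheaf of `P`. -/
structure CechPair.Hom (P Q : CechPair.{u} R) where
  toMap : P.space ⟶ Q.space
  preimage_mem : ∀ U ∈ Q.basis.carrier, (Opens.map toMap).obj U ∈ P.basis.carrier
  comap : Q.presheaf ⟶ (preimageFunctor toMap P.basis Q.basis preimage_mem).op ⋙ P.presheaf

/-- The map `Γ_Q(U) → Γ_P(φ⁻¹(U)) → Γ_P(W)` for `W ⊆ φ⁻¹(U)`. -/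
def CechPair.Hom.ev {P Q : CechPair.{u} R} (α : P.Hom Q) {U : Q.basis.carrier}
    {W : P.basis.carrier} (h : W.1 ≤ (Opens.map α.toMap).obj U.1) :
    Q.presheaf.obj (op U) ⟶ P.presheaf.obj (op W) :=
  α.comap.app (op U) ≫
    P.presheaf.res (U := (preimageFunctor _ _ _ α.preimage_mem).obj U) h

theorem CechPair.Hom.res_ev {P Q : CechPair.{u} R} (α : P.Hom Q) {U : Q.basis.carrier}
    {W W' : P.basis.carrier} (h : W.1 ≤ (Opens.map α.toMap).obj U.1) (h' : W' ≤ W)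
    (x : Q.presheaf.obj (op U)) :
    P.presheaf.res h' (α.ev h x) = α.ev (le_trans (α := Opens P.space) h' h) x :=
  P.presheaf.res_res _ _ _

theorem CechPair.Hom.ev_res {P Q : CechPair.{u} R} (α : P.Hom Q) {U U' : Q.basis.carrier}
    {W : P.basis.carrier} (h : W.1 ≤ (Opens.map α.toMap).obj U'.1) (h' : U' ≤ U)
    (x : Q.presheaf.obj (op U)) :
    α.ev h (Q.presheaf.res h' x) = α.ev (h.trans fun _ hx => h' hx) x := by
  have := congrArg (fun f => P.presheaf.res
    (U := (preimageFunctor _ _ _ α.preimage_mem).obj U') h (f.hom x))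
    (α.comap.naturality (homOfLE h').op)
  refine Eq.trans this ?_
  exact P.presheaf.res_res (U := (preimageFunctor _ _ _ α.preimage_mem).obj U)
    (V := (preimageFunctor _ _ _ α.preimage_mem).obj U') (fun _ hx => h' hx) h
    (α.comap.app (op U) x)

/-- The identity map of spaces and presheaves. -/
def CechPair.Hom.id (P : CechPair.{u} R) : P.Hom P where
  toMap := 𝟙 _
  preimage_mem _ hU := hU
  comap := { app := fun _ => 𝟙 _ }

theorem OpenBasis.iInf_mem {X : TopCat.{u}} (B : OpenBasis X) {n : ℕ}
    (t : Fin (n + 1) → Opens X) (ht : ∀ i, t i ∈ B.carrier) : ⨅ i, t i ∈ B.carrier := by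
  induction n with
  | zero =>
    have : ⨅ i, t i = t 0 := le_antisymm (iInf_le _ _) (le_iInf fun i => by rw [Fin.fin_one_eq_zero i])
    rw [this]
    exact ht 0
  | succ n ih =>
    have : ⨅ i, t i = t 0 ⊓ ⨅ i : Fin (n + 1), t i.succ :=
      le_antisymm (le_inf (iInf_le _ _) (le_iInf fun i => iInf_le _ _))
        (le_iInf fun i => Fin.cases inf_le_left (fun i => inf_le_right.trans (iInf_le _ i)) i)
    rw [this]
    exact B.inf_mem _ (ht 0) _ (ih _ fun i => ht _)

/-- The intersection `U₀ ∩ ⋯ ∩ Uₙ` of a tuple of members of a cover. -/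
def Cover.inter {X : TopCat.{u}} {B : OpenBasis X} {W : Opens X} {𝓤 : Cover B W} {n : ℕ}
    (t : Fin (n + 1) → 𝓤.carrier) : B.carrier :=
  ⟨⨅ i, (t i).1, B.iInf_mem _ fun i => 𝓤.subset (t i).2⟩

theorem Cover.inter_le_comp {X : TopCat.{u}} {B : OpenBasis X} {W : Opens X} {𝓤 : Cover B W}
    {m n : ℕ} (t : Fin (n + 1) → 𝓤.carrier) (θ : Fin (m + 1) → Fin (n + 1)) :
    Cover.inter t ≤ Cover.inter (t ∘ θ) :=
  le_iInf (α := Opens X) fun i => iInf_le (fun i => (t i).1) (θ i)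

/-- The cosimplicial module of Čech cochains: `n`-cochains are the functions assigning to each
tuple `(U₀, …, Uₙ)` of members of `𝓤` an element of `Γ(U₀ ∩ ⋯ ∩ Uₙ)`; a monotone map `θ` acts by
`(θ f)(t) = f(t ∘ θ)|`. -/
def cechCosimplicial (P : CechPair.{u} R) (𝓤 : Cover P.basis ⊤) :
    CosimplicialObject (ModuleCat.{u} R) where
  obj n := ModuleCat.of R
    (∀ t : Fin (n.len + 1) → 𝓤.carrier, P.presheaf.obj (op (Cover.inter t)))
  map θ := ModuleCat.ofHom (LinearMap.pi fun t =>
    (P.presheaf.res (Cover.inter_le_comp t θ.toOrderHom)).hom ∘ₗ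
      LinearMap.proj (φ := fun t => P.presheaf.obj (op (Cover.inter t))) (t ∘ θ.toOrderHom))
  map_id _ := ModuleCat.hom_ext <| LinearMap.ext fun _ => funext fun _ =>
    P.presheaf.res_self _ _
  map_comp _ _ := ModuleCat.hom_ext <| LinearMap.ext fun _ => funext fun _ =>
    (P.presheaf.res_res _ _ _).symm

/-- The Čech complex `Č*(𝓤, Γ)`, with differential the alternating sum
`(∂ f)(U₀, …, Uₙ₊₁) = ∑ (-1)ⁱ f(U₀, …, Ûᵢ, …, Uₙ₊₁)|`. -/
def cechComplex (P : CechPair.{u} R) (𝓤 : Cover P.basis ⊤) :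
    CochainComplex (ModuleCat.{u} R) ℕ :=
  (AlgebraicTopology.alternatingCofaceMapComplex _).obj (cechCosimplicial P 𝓤)

theorem cechComplex_d_apply (P : CechPair.{u} R) (𝓤 : Cover P.basis ⊤) (n : ℕ)
    (f : ∀ t : Fin (n + 1) → 𝓤.carrier, P.presheaf.obj (op (Cover.inter t)))
    (t : Fin (n + 2) → 𝓤.carrier) :
    (((cechComplex P 𝓤).d n (n + 1)).hom f :
      ∀ t : Fin (n + 2) → 𝓤.carrier, P.presheaf.obj (op (Cover.inter t))) t =
    ∑ i : Fin (n + 2), (-1 : ℤ) ^ (i : ℕ) •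
      P.presheaf.res (Cover.inter_le_comp t i.succAbove) (f (t ∘ i.succAbove)) := by
  have hd : (cechComplex P 𝓤).d n (n + 1) =
      AlgebraicTopology.AlternatingCofaceMapComplex.objD (cechCosimplicial P 𝓤) n :=
    CochainComplex.of_d (fun n => (cechCosimplicial P 𝓤).obj (SimplexCategory.mk n))
      (AlgebraicTopology.AlternatingCofaceMapComplex.objD (cechCosimplicial P 𝓤)) n
  let g : ((cechCosimplicial P 𝓤).obj (SimplexCategory.mk n) ⟶
      (cechCosimplicial P 𝓤).obj (SimplexCategory.mk (n + 1))) →+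
      P.presheaf.obj (op (Cover.inter t)) :=
    { toFun := fun φ => (φ.hom f : ∀ t : Fin (n + 2) → 𝓤.carrier,
        P.presheaf.obj (op (Cover.inter t))) t
      map_zero' := rfl
      map_add' := fun _ _ => rfl }
  refine (congrArg g hd).trans ?_
  refine (map_sum g _ _).trans (Finset.sum_congr rfl fun i _ => ?_)
  exact map_zsmul g _ _

section CochainMap

variable {P Q : CechPair.{u} R} (α : P.Hom Q)

/-- The cover `𝓥` of the space of `P` refines the preimage of the cover `𝓤` of the space
of `Q`. -/
def RefinesPreimage (𝓤 : Cover Q.basis ⊤) (𝓥 : Cover P.basis ⊤) : Prop :=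
  ∀ V ∈ 𝓥.carrier, ∃ U ∈ 𝓤.carrier, V ≤ (Opens.map α.toMap).obj U

variable {𝓤 : Cover Q.basis ⊤} {𝓥 : Cover P.basis ⊤}

theorem le_map_iInf {X Y : TopCat.{u}} (φ : X ⟶ Y) {n : ℕ} (t : Fin n → Opens Y) (W : Opens X)
    (h : ∀ i, W ≤ (Opens.map φ).obj (t i)) : W ≤ (Opens.map φ).obj (⨅ i, t i) := by
  intro x hx
  change φ x ∈ ((⨅ i, t i : Opens Y) : Set Y)
  rw [Opens.coe_iInf]
  exact Set.mem_iInter.2 fun i => h i hx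

theorem inter_le_map_inter (l : 𝓥.carrier → 𝓤.carrier)
    (hl : ∀ V, V.1 ≤ (Opens.map α.toMap).obj (l V).1) {n : ℕ} (t : Fin (n + 1) → 𝓥.carrier) :
    (Cover.inter t).1 ≤ (Opens.map α.toMap).obj (Cover.inter (l ∘ t)).1 :=
  le_map_iInf _ _ _ fun i => (iInf_le (fun i => (t i).1) i).trans (hl (t i))

variable (l : 𝓥.carrier → 𝓤.carrier) (hl : ∀ V, V.1 ≤ (Opens.map α.toMap).obj (l V).1)

/-- The map of cosimplicial modules `f ↦ ((V₀, …, Vₙ) ↦ f(l(V₀), …, l(Vₙ))|)` determined by a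
function `l : 𝓥 → 𝓤` with `V ⊆ φ⁻¹(l(V))`; here `|` stands for the map
`Γ_Q(l(V₀) ∩ ⋯ ∩ l(Vₙ)) → Γ_P(V₀ ∩ ⋯ ∩ Vₙ)`. -/
def cechCosimplicialMap : cechCosimplicial Q 𝓤 ⟶ cechCosimplicial P 𝓥 where
  app n := ModuleCat.ofHom (LinearMap.pi fun t : Fin (n.len + 1) → 𝓥.carrier =>
    (α.ev (inter_le_map_inter α l hl t)).hom ∘ₗ
      LinearMap.proj (φ := fun t => Q.presheaf.obj (op (Cover.inter t))) (l ∘ t))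
  naturality _ _ _ := ModuleCat.hom_ext <| LinearMap.ext fun _ => funext fun _ =>
    (α.ev_res _ _ _).trans (α.res_ev _ _ _).symm

/-- The induced cochain map `Č*(𝓤, Γ_Q) → Č*(𝓥, Γ_P)`. -/
def cechComplexMap : cechComplex Q 𝓤 ⟶ cechComplex P 𝓥 :=
  (AlgebraicTopology.alternatingCofaceMapComplex _).map (cechCosimplicialMap α l hl)

theorem cechComplexMap_apply (n : ℕ)
    (f : ∀ t : Fin (n + 1) → 𝓤.carrier, Q.presheaf.obj (op (Cover.inter t)))
    (t : Fin (n + 1) → 𝓥.carrier) :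
    (((cechComplexMap α l hl).f n).hom f :
      ∀ t : Fin (n + 1) → 𝓥.carrier, P.presheaf.obj (op (Cover.inter t))) t =
    α.ev (inter_le_map_inter α l hl t) (f (l ∘ t)) := rfl

end CochainMap

/-! ### The cochain homotopy between two refinement maps -/

section Prism

variable {T M : Type*} [AddCommGroup M]

/-- The alternating sum `∑ (-1)ⁱ F(x₀, …, x̂ᵢ, …, xₙ)`. -/
def listD (F : List T → M) : List T → M
  | [] => 0
  | x :: s => F s - listD (fun m => F (x :: m)) s

/-- The prism operator `∑ (-1)ʲ F(a₀, …, aⱼ, bⱼ, …, bₙ)`. -/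
def listP (F : List T → M) : List (T × T) → M
  | [] => 0
  | x :: s => F (x.1 :: x.2 :: s.map Prod.snd) - listP (fun m => F (x.1 :: m)) s

theorem listD_sub (F G : List T → M) (s : List T) :
    listD (fun m => F m - G m) s = listD F s - listD G s := by
  induction s generalizing F G with
  | nil => simp [listD]
  | cons x s ih => simp only [listD, ih]; abel

theorem listP_sub (F G : List T → M) (s : List (T × T)) :
    listP (fun m => F m - G m) s = listP F s - listP G s := by
  induction s generalizing F G with
  | nil => simp [listP]
  | cons x s ih => simp only [listP, ih]; abel

theorem prism (F : List T → M) (s : List (T × T)) :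
    listP (listD F) s + listD (listP F) s = F (s.map Prod.snd) - F (s.map Prod.fst) := by
  induction s generalizing F with
  | nil => simp [listP, listD]
  | cons x s ih =>
    have h := ih (fun m => F (x.1 :: m))
    have e₁ : listD (listP fun m => F (x.1 :: m)) s + listD (fun m => listP F (x :: m)) s =
        listD (fun m => F (x.1 :: x.2 :: m.map Prod.snd)) s := by
      simp only [listP, listD_sub]; abel
    have e₂ : ∀ (G : List T → M) (s : List (T × T)),
        listD (fun m => G (m.map Prod.snd)) s = listD G (s.map Prod.snd) := by
      intro G s
      induction s generalizing G with
      | nil => rfl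
      | cons y s ih' => simp only [listD, List.map_cons, ← ih']
    rw [e₂ (fun m => F (x.1 :: x.2 :: m))] at e₁
    have e₃ : listP (listD F) (x :: s) + listD (listP F) (x :: s) =
        F (x.2 :: s.map Prod.snd) - listD (fun m => F (x.1 :: m)) (x.2 :: s.map Prod.snd) +
          listP (listD fun m => F (x.1 :: m)) s - listD (fun m => listP F (x :: m)) s := by
      rw [listP, listD, show listD (listP F) (x :: s) = listP F s -
        listD (fun m => listP F (x :: m)) s from rfl]
      rw [show (fun m => listD F (x.1 :: m)) =
        fun m => F m - listD (fun m => F (x.1 :: m)) m from rfl, listP_sub]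
      abel
    rw [e₃, eq_sub_of_add_eq' e₁, eq_sub_of_add_eq h, List.map_cons, List.map_cons, listD]
    abel

theorem listD_ofFn {n : ℕ} (F : List T → M) (t : Fin (n + 1) → T) :
    listD F (List.ofFn t) =
      ∑ i : Fin (n + 1), (-1 : ℤ) ^ (i : ℕ) • F (List.ofFn (t ∘ i.succAbove)) := by
  induction n generalizing F with
  | zero => simp [listD]
  | succ n ih =>
    rw [List.ofFn_succ, listD, ih, Fin.sum_univ_succ (n := n + 1), sub_eq_add_neg,
      ← Finset.sum_neg_distrib]
    congr 1
    · simp [Function.comp_def]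
    · refine Finset.sum_congr rfl fun i _ => ?_
      rw [List.ofFn_succ (f := t ∘ i.succ.succAbove)]
      simp [Function.comp_def, pow_succ]

theorem listP_congr {F G : List T → M} (s : List (T × T))
    (h : ∀ m, m.length = s.length + 1 → F m = G m) : listP F s = listP G s := by
  induction s generalizing F G with
  | nil => rfl
  | cons x s ih =>
    simp only [listP]
    rw [h _ (by simp), ih fun m hm => h _ (by simpa using hm)]

theorem map_listP {N : Type*} [AddCommGroup N] (g : M →+ N) (F : List T → M)
    (s : List (T × T)) : g (listP F s) = listP (fun m => g (F m)) s := by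
  induction s generalizing F with
  | nil => simp [listP]
  | cons x s ih => simp [listP, ih]

theorem listP_map {T' : Type*} (j : T' → T) (F : List T → M) (s : List (T' × T')) :
    listP F (s.map (Prod.map j j)) = listP (fun m => F (m.map j)) s := by
  induction s generalizing F with
  | nil => rfl
  | cons x s ih =>
    simp only [listP, List.map_cons, ih]
    simp [Function.comp_def]

theorem listP_add (F G : List T → M) (s : List (T × T)) :
    listP (fun m => F m + G m) s = listP F s + listP G s := by
  induction s generalizing F G with
  | nil => simp [listP]
  | cons x s ih => simp only [listP, ih]; abel

end Prism

section Homotopy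

variable {P Q : CechPair.{u} R} (α : P.Hom Q) {𝓤 : Cover Q.basis ⊤} {𝓥 : Cover P.basis ⊤}

/-- The members of `𝓤` whose preimage contains `W`. -/
abbrev Above (𝓤 : Cover Q.basis ⊤) (W : P.basis.carrier) :=
  {U : 𝓤.carrier // W.1 ≤ (Opens.map α.toMap).obj U.1}

theorem le_inter_get {W : P.basis.carrier} {n : ℕ} (t : Fin (n + 1) → Above α 𝓤 W) :
    W.1 ≤ (Opens.map α.toMap).obj (Cover.inter fun i => (t i).1).1 :=
  le_map_iInf _ _ _ fun i => (t i).2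

/-- An `n`-cochain, evaluated on lists of length `n + 1` and restricted to `W`. -/
def evList (n : ℕ) (W : P.basis.carrier)
    (f : ∀ t : Fin (n + 1) → 𝓤.carrier, Q.presheaf.obj (op (Cover.inter t)))
    (s : List (Above α 𝓤 W)) : P.presheaf.obj (op W) :=
  if h : s.length = n + 1 then
    α.ev (le_inter_get α fun i => s.get (i.cast h.symm)) (f fun i => (s.get (i.cast h.symm)).1)
  else 0

theorem ev_congr {n : ℕ} {W : P.basis.carrier}
    (f : ∀ t : Fin (n + 1) → 𝓤.carrier, Q.presheaf.obj (op (Cover.inter t)))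
    {t t' : Fin (n + 1) → 𝓤.carrier} (e : t = t')
    (h : W.1 ≤ (Opens.map α.toMap).obj (Cover.inter t).1)
    (h' : W.1 ≤ (Opens.map α.toMap).obj (Cover.inter t').1) :
    α.ev h (f t) = α.ev h' (f t') := by
  subst e; rfl

theorem evList_ofFn {n : ℕ} {W : P.basis.carrier}
    (f : ∀ t : Fin (n + 1) → 𝓤.carrier, Q.presheaf.obj (op (Cover.inter t)))
    (t : Fin (n + 1) → Above α 𝓤 W) :
    evList α n W f (List.ofFn t) = α.ev (le_inter_get α t) (f fun i => (t i).1) := by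
  rw [evList, dif_pos (by simp)]
  apply ev_congr
  funext i
  rw [List.get_ofFn]
  rfl

theorem exists_ofFn {T : Type*} {n : ℕ} (s : List T) (h : s.length = n) :
    ∃ t : Fin n → T, s = List.ofFn t := by
  subst h; exact ⟨s.get, (List.ofFn_get s).symm⟩

theorem evList_d {n : ℕ} {W : P.basis.carrier}
    (f : ∀ t : Fin (n + 1) → 𝓤.carrier, Q.presheaf.obj (op (Cover.inter t)))
    (s : List (Above α 𝓤 W)) (hs : s.length = n + 2) :
    evList α (n + 1) W (((cechComplex Q 𝓤).d n (n + 1)).hom f) s = listD (evList α n W f) s := by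
  obtain ⟨t, rfl⟩ := exists_ofFn s hs
  refine (evList_ofFn α _ t).trans ?_
  rw [listD_ofFn]
  refine (congrArg (α.ev (le_inter_get α t)) (cechComplex_d_apply Q 𝓤 n f _)).trans ?_
  rw [map_sum]
  refine Finset.sum_congr rfl fun i _ => ?_
  rw [map_zsmul, evList_ofFn]
  exact congrArg _ (α.ev_res _ _ _)

theorem res_evList {n : ℕ} {W W' : P.basis.carrier} (h : W' ≤ W)
    (f : ∀ t : Fin (n + 1) → 𝓤.carrier, Q.presheaf.obj (op (Cover.inter t)))
    (s : List (Above α 𝓤 W)) :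
    P.presheaf.res h (evList α n W f s) = evList α n W' f
      (s.map fun U => ⟨U.1, le_trans (α := Opens P.space) h U.2⟩) := by
  by_cases hs : s.length = n + 1
  · obtain ⟨t, rfl⟩ := exists_ofFn s hs
    rw [evList_ofFn, List.map_ofFn, evList_ofFn]
    exact α.res_ev _ _ _
  · rw [evList, evList, dif_neg hs, dif_neg (by simpa using hs), map_zero]

variable (l l' : 𝓥.carrier → 𝓤.carrier)
  (hl : ∀ V, V.1 ≤ (Opens.map α.toMap).obj (l V).1)
  (hl' : ∀ V, V.1 ≤ (Opens.map α.toMap).obj (l' V).1)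

/-- The list of the pairs `(l(Vᵢ), l'(Vᵢ))`. -/
def pairList {n : ℕ} (t : Fin (n + 1) → 𝓥.carrier) (W : P.basis.carrier)
    (hW : ∀ i, W.1 ≤ (t i).1) : List (Above α 𝓤 W × Above α 𝓤 W) :=
  List.ofFn fun i => (⟨l (t i), (hW i).trans (hl (t i))⟩, ⟨l' (t i), (hW i).trans (hl' (t i))⟩)

theorem inter_le {n : ℕ} (t : Fin (n + 1) → 𝓥.carrier) (i : Fin (n + 1)) :
    (Cover.inter t).1 ≤ (t i).1 := iInf_le (fun i => (t i).1) i

/-- The homotopy operator `Čⁿ⁺¹(𝓤, Γ_Q) → Čⁿ(𝓥, Γ_P)`. -/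
def homotopyOp (n : ℕ) : (cechComplex Q 𝓤).X (n + 1) ⟶ (cechComplex P 𝓥).X n :=
  ModuleCat.ofHom (X := ∀ t : Fin (n + 2) → 𝓤.carrier, Q.presheaf.obj (op (Cover.inter t)))
    (Y := ∀ t : Fin (n + 1) → 𝓥.carrier, P.presheaf.obj (op (Cover.inter t)))
    { toFun := fun f t => listP (evList α (n + 1) (Cover.inter t) f)
        (pairList α l l' hl hl' t (Cover.inter t) (inter_le t))
      map_add' := fun f g => funext fun t => by
        refine Eq.trans ?_ (listP_add _ _ _)
        congr 1
        funext s
        by_cases hs : s.length = n + 1 + 1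
        · simp [evList, hs]
        · simp [evList, hs]
      map_smul' := fun r f => funext fun t => by
        refine Eq.trans ?_ (map_listP (DistribSMul.toAddMonoidHom _ r) _ _).symm
        congr 1
        funext s
        by_cases hs : s.length = n + 1 + 1
        · simp [evList, hs]
        · simp [evList, hs] }

theorem homotopyOp_apply (n : ℕ)
    (f : ∀ t : Fin (n + 2) → 𝓤.carrier, Q.presheaf.obj (op (Cover.inter t)))
    (t : Fin (n + 1) → 𝓥.carrier) :
    ((homotopyOp α l l' hl hl' n).hom f :
      ∀ t : Fin (n + 1) → 𝓥.carrier, P.presheaf.obj (op (Cover.inter t))) t =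
      listP (evList α (n + 1) (Cover.inter t) f)
        (pairList α l l' hl hl' t (Cover.inter t) (inter_le t)) := rfl

theorem listP_evList_d (n : ℕ)
    (f : ∀ t : Fin (n + 1) → 𝓤.carrier, Q.presheaf.obj (op (Cover.inter t)))
    (t : Fin (n + 1) → 𝓥.carrier) :
    ((homotopyOp α l l' hl hl' n).hom (((cechComplex Q 𝓤).d n (n + 1)).hom f) :
      ∀ t : Fin (n + 1) → 𝓥.carrier, P.presheaf.obj (op (Cover.inter t))) t =
      listP (listD (evList α n (Cover.inter t) f))
        (pairList α l l' hl hl' t (Cover.inter t) (inter_le t)) :=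
  listP_congr _ fun m hm => evList_d α f m (by rw [hm, pairList, List.length_ofFn])

theorem evList_snd (n : ℕ)
    (f : ∀ t : Fin (n + 1) → 𝓤.carrier, Q.presheaf.obj (op (Cover.inter t)))
    (t : Fin (n + 1) → 𝓥.carrier) :
    evList α n (Cover.inter t) f
      ((pairList α l l' hl hl' t (Cover.inter t) (inter_le t)).map Prod.snd) =
    (((cechComplexMap α l' hl').f n).hom f :
      ∀ t : Fin (n + 1) → 𝓥.carrier, P.presheaf.obj (op (Cover.inter t))) t := by
  rw [pairList, List.map_ofFn, evList_ofFn]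
  rfl

theorem evList_fst (n : ℕ)
    (f : ∀ t : Fin (n + 1) → 𝓤.carrier, Q.presheaf.obj (op (Cover.inter t)))
    (t : Fin (n + 1) → 𝓥.carrier) :
    evList α n (Cover.inter t) f
      ((pairList α l l' hl hl' t (Cover.inter t) (inter_le t)).map Prod.fst) =
    (((cechComplexMap α l hl).f n).hom f :
      ∀ t : Fin (n + 1) → 𝓥.carrier, P.presheaf.obj (op (Cover.inter t))) t := by
  rw [pairList, List.map_ofFn, evList_ofFn]
  rfl

theorem homotopy_zero :
    (cechComplexMap α l' hl').f 0 - (cechComplexMap α l hl).f 0 =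
      (cechComplex Q 𝓤).d 0 1 ≫ homotopyOp α l l' hl hl' 0 := by
  refine ModuleCat.hom_ext <| LinearMap.ext fun f => funext fun t => ?_
  refine Eq.trans ?_ (listP_evList_d α l l' hl hl' 0 f t).symm
  have h := prism (evList α 0 (Cover.inter t) f)
    (pairList α l l' hl hl' t (Cover.inter t) (inter_le t))
  refine (congrArg₂ (· - ·) (evList_snd α l l' hl hl' 0 f t).symm
    (evList_fst α l l' hl hl' 0 f t).symm).trans (h.symm.trans ?_)
  simp [pairList, listD, listP]

theorem homotopy_succ (n : ℕ) :
    (cechComplexMap α l' hl').f (n + 1) - (cechComplexMap α l hl).f (n + 1) =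
      (cechComplex Q 𝓤).d (n + 1) (n + 2) ≫ homotopyOp α l l' hl hl' (n + 1) +
        homotopyOp α l l' hl hl' n ≫ (cechComplex P 𝓥).d n (n + 1) := by
  refine ModuleCat.hom_ext <| LinearMap.ext fun f => funext fun t => ?_
  have h := prism (evList α (n + 1) (Cover.inter t) f)
    (pairList α l l' hl hl' t (Cover.inter t) (inter_le t))
  refine (congrArg₂ (· - ·) (evList_snd α l l' hl hl' (n + 1) f t).symm
    (evList_fst α l l' hl hl' (n + 1) f t).symm).trans (h.symm.trans ?_)
  refine congrArg₂ (· + ·) (listP_evList_d α l l' hl hl' (n + 1) f t).symm ?_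
  refine Eq.trans ?_ (cechComplex_d_apply P 𝓥 n _ t).symm
  rw [pairList, listD_ofFn]
  refine Finset.sum_congr rfl fun i _ => congrArg _ ?_
  refine Eq.trans ?_ (congrArg _ (homotopyOp_apply α l l' hl hl' n f _).symm)
  refine Eq.trans ?_ (map_listP (P.presheaf.res _).hom.toAddMonoidHom _ _).symm
  refine Eq.trans ?_ (congrArg (fun F => listP F _) (funext fun s =>
    (res_evList α (Cover.inter_le_comp t i.succAbove) f s).symm))
  refine Eq.trans ?_ (listP_map _ _ _)
  congr 1
  rw [pairList, List.map_ofFn]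
  rfl

theorem homologyMap_cechComplexMap_eq (n : ℕ) :
    HomologicalComplex.homologyMap (cechComplexMap α l hl) n =
      HomologicalComplex.homologyMap (cechComplexMap α l' hl') n := by
  let h : ∀ i j, (ComplexShape.up ℕ).Rel j i →
      ((cechComplex Q 𝓤).X i ⟶ (cechComplex P 𝓥).X j) :=
    fun i j hij => eqToHom (by rw [← hij]) ≫ homotopyOp α l l' hl hl' j
  have key : cechComplexMap α l' hl' - cechComplexMap α l hl = Homotopy.nullHomotopicMap' h := by
    ext1 m
    rw [HomologicalComplex.sub_f_apply]
    cases m with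
    | zero =>
      rw [homotopy_zero α l l' hl hl', Homotopy.nullHomotopicMap'_f_of_not_rel_right (k₁ := 0)
        (k₀ := 1) rfl (by simp)]
      simp [h]
    | succ m =>
      rw [homotopy_succ α l l' hl hl', Homotopy.nullHomotopicMap'_f (k₂ := m) (k₀ := m + 2)
        (k₁ := m + 1) rfl rfl]
      simp [h]
  have h0 := (Homotopy.nullHomotopy' h).homologyMap_eq n
  rw [← key, HomologicalComplex.homologyMap_sub, HomologicalComplex.homologyMap_zero] at h0
  exact (sub_eq_zero.1 h0).symm

end Homotopy

/-! ### The cohomology groups -/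

/-- The cohomology `Ȟⁿ(𝓤, Γ)` of a cover. -/
def coverCohomology (P : CechPair.{u} R) (𝓤 : Cover P.basis ⊤) (n : ℕ) : ModuleCat.{u} R :=
  (cechComplex P 𝓤).homology n

section CoverMap

variable {P Q S : CechPair.{u} R}

/-- The map `Ȟⁿ(𝓤, Γ_Q) → Ȟⁿ(𝓥, Γ_P)` induced by any function `l : 𝓥 → 𝓤` such that
`V ⊆ φ⁻¹(l(V))`; see `coverMap_eq` for the independence of the choice. -/
def coverMap (α : P.Hom Q) {𝓤 : Cover Q.basis ⊤} {𝓥 : Cover P.basis ⊤}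
    (h : RefinesPreimage α 𝓤 𝓥) (n : ℕ) : coverCohomology Q 𝓤 n ⟶ coverCohomology P 𝓥 n :=
  HomologicalComplex.homologyMap
    (cechComplexMap α (fun V => ⟨(h V.1 V.2).choose, (h V.1 V.2).choose_spec.1⟩)
      (fun V => (h V.1 V.2).choose_spec.2)) n

theorem coverMap_eq (α : P.Hom Q) {𝓤 : Cover Q.basis ⊤} {𝓥 : Cover P.basis ⊤}
    (h : RefinesPreimage α 𝓤 𝓥) (n : ℕ) (l : 𝓥.carrier → 𝓤.carrier)
    (hl : ∀ V, V.1 ≤ (Opens.map α.toMap).obj (l V).1) :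
    coverMap α h n = HomologicalComplex.homologyMap (cechComplexMap α l hl) n :=
  homologyMap_cechComplexMap_eq α _ _ _ _ n

/-- `γ` is the composite of `α : P ⟶ Q` and `β : Q ⟶ S`. -/
structure IsComp (α : P.Hom Q) (β : Q.Hom S) (γ : P.Hom S) : Prop where
  toMap_eq : α.toMap ≫ β.toMap = γ.toMap
  ev_eq : ∀ {U : S.basis.carrier} {V : Q.basis.carrier} {W : P.basis.carrier}
    (hV : V.1 ≤ (Opens.map β.toMap).obj U.1) (hW : W.1 ≤ (Opens.map α.toMap).obj V.1)
    (hW' : W.1 ≤ (Opens.map γ.toMap).obj U.1) (x : S.presheaf.obj (op U)),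
    α.ev hW (β.ev hV x) = γ.ev hW' x

/-- `α` is the identity. -/
structure IsId (α : P.Hom P) : Prop where
  toMap_eq : α.toMap = 𝟙 _
  ev_eq : ∀ {U : P.basis.carrier} (h : U.1 ≤ (Opens.map α.toMap).obj U.1)
    (x : P.presheaf.obj (op U)), α.ev h x = x

theorem CechPair.Hom.id_ev {U W : P.basis.carrier} (h : W ≤ U) (x : P.presheaf.obj (op U)) :
    (CechPair.Hom.id P).ev (U := U) (W := W) h x = P.presheaf.res h x := rfl

theorem isId_id (P : CechPair.{u} R) : IsId (CechPair.Hom.id P) :=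
  ⟨rfl, fun _ _ => P.presheaf.res_self _ _⟩

theorem isComp_id_left (α : P.Hom Q) : IsComp (CechPair.Hom.id P) α α :=
  ⟨Category.id_comp _, fun hV hW _ x => α.res_ev hV hW x⟩

theorem isComp_id_right (α : P.Hom Q) : IsComp α (CechPair.Hom.id Q) α :=
  ⟨Category.comp_id _, fun hV hW _ x => α.ev_res hW hV x⟩

theorem coverMap_comp {α : P.Hom Q} {β : Q.Hom S} {γ : P.Hom S} (hc : IsComp α β γ)
    {𝓤 : Cover S.basis ⊤} {𝓥 : Cover Q.basis ⊤} {𝓦 : Cover P.basis ⊤}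
    (h : RefinesPreimage β 𝓤 𝓥) (h' : RefinesPreimage α 𝓥 𝓦) (h'' : RefinesPreimage γ 𝓤 𝓦)
    (n : ℕ) : coverMap β h n ≫ coverMap α h' n = coverMap γ h'' n := by
  have h₁ : ∀ V ∈ 𝓥.carrier, ∃ U ∈ 𝓤.carrier, V ≤ (Opens.map β.toMap).obj U := h
  have h₂ : ∀ W ∈ 𝓦.carrier, ∃ V ∈ 𝓥.carrier, W ≤ (Opens.map α.toMap).obj V := h'
  choose l hl hl' using h₁
  choose m hm hm' using h₂
  have hlm : ∀ W : 𝓦.carrier, W.1 ≤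
      (Opens.map γ.toMap).obj (l (m W.1 W.2) (hm W.1 W.2)) := fun W => by
    rw [← hc.toMap_eq]
    exact fun x hx => hl' _ _ (hm' W.1 W.2 hx)
  rw [coverMap_eq β _ n (fun V => ⟨l V.1 V.2, hl V.1 V.2⟩) (fun V => hl' V.1 V.2),
    coverMap_eq α _ n (fun V => ⟨m V.1 V.2, hm V.1 V.2⟩) (fun V => hm' V.1 V.2),
    coverMap_eq γ _ n (fun V => ⟨l _ (hm V.1 V.2), hl _ _⟩) hlm]
  refine (HomologicalComplex.homologyMap_comp _ _ _).symm.trans ?_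
  congr 1
  ext1 k
  exact ModuleCat.hom_ext <| LinearMap.ext fun f => funext fun t => hc.ev_eq _ _ _ _

theorem coverMap_self {α : P.Hom P} (hα : IsId α) {𝓤 : Cover P.basis ⊤}
    (h : RefinesPreimage α 𝓤 𝓤) (n : ℕ) : coverMap α h n = 𝟙 _ := by
  rw [coverMap_eq α _ n _root_.id (fun V => by rw [hα.toMap_eq]; exact le_rfl)]
  refine Eq.trans ?_ (HomologicalComplex.homologyMap_id _ _)
  congr 1
  ext1 k
  exact ModuleCat.hom_ext <| LinearMap.ext fun f => funext fun t => hα.ev_eq _ _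

end CoverMap

/-- The direct system of the `Ȟⁿ(𝓤, Γ)` over the covers `𝓤` of the space by members of the
basis, ordered by refinement. -/
def coverCohomologyFunctor (P : CechPair.{u} R) (n : ℕ) : Cover P.basis ⊤ ⥤ ModuleCat.{u} R where
  obj 𝓤 := coverCohomology P 𝓤 n
  map f := coverMap (CechPair.Hom.id P) (leOfHom f) n
  map_id _ := coverMap_self (isId_id P) _ n
  map_comp f g := (coverMap_comp (isComp_id_left (CechPair.Hom.id P)) (leOfHom f) (leOfHom g) _
    n).symm

/-- The Čech cohomology `Ȟⁿ(X, Γ)`, the direct limit of the `Ȟⁿ(𝓤, Γ)`. -/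
def cechCohomology (P : CechPair.{u} R) (n : ℕ) : ModuleCat.{u} R :=
  colimit (coverCohomologyFunctor P n)

/-- The canonical map `Ȟⁿ(𝓤, Γ) → Ȟⁿ(X, Γ)`. -/
def cechι (P : CechPair.{u} R) (n : ℕ) (𝓤 : Cover P.basis ⊤) :
    coverCohomology P 𝓤 n ⟶ cechCohomology P n :=
  colimit.ι (coverCohomologyFunctor P n) 𝓤

section CohomologyMap

variable {P Q S : CechPair.{u} R}

theorem cech_w (n : ℕ) {𝓤 𝓥 : Cover P.basis ⊤} (h : 𝓤 ≤ 𝓥) :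
    coverMap (CechPair.Hom.id P) h n ≫ cechι P n 𝓥 = cechι P n 𝓤 :=
  colimit.w (coverCohomologyFunctor P n) (homOfLE h)

theorem cech_hom_ext (n : ℕ) {M : ModuleCat.{u} R} {f g : cechCohomology P n ⟶ M}
    (h : ∀ 𝓤, cechι P n 𝓤 ≫ f = cechι P n 𝓤 ≫ g) : f = g :=
  colimit.hom_ext h

/-- The cover `φ⁻¹(𝓤) = {φ⁻¹(U) | U ∈ 𝓤}`. -/
def preimageCover (α : P.Hom Q) (𝓤 : Cover Q.basis ⊤) : Cover P.basis ⊤ where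
  carrier := {V | ∃ U ∈ 𝓤.carrier, (Opens.map α.toMap).obj U = V}
  subset := by
    rintro _ ⟨U, hU, rfl⟩
    exact α.preimage_mem U (𝓤.subset hU)
  sSup_eq := by
    refine top_le_iff.1 fun x _ => ?_
    have hx : α.toMap x ∈ sSup 𝓤.carrier := by rw [𝓤.sSup_eq]; trivial
    obtain ⟨U, hU, hxU⟩ := Opens.mem_sSup.1 hx
    exact Opens.mem_sSup.2 ⟨_, ⟨U, hU, rfl⟩, hxU⟩

theorem refines_preimageCover (α : P.Hom Q) (𝓤 : Cover Q.basis ⊤) :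
    RefinesPreimage α 𝓤 (preimageCover α 𝓤) := by
  rintro _ ⟨U, hU, rfl⟩
  exact ⟨U, hU, le_rfl⟩

theorem RefinesPreimage.preimageCover_le {α : P.Hom Q} {𝓤 : Cover Q.basis ⊤}
    {𝓥 : Cover P.basis ⊤} (h : RefinesPreimage α 𝓤 𝓥) : preimageCover α 𝓤 ≤ 𝓥 := fun V hV =>
  have ⟨U, hU, hVU⟩ := h V hV
  ⟨_, ⟨U, hU, rfl⟩, hVU⟩

/-- The homomorphism `Ȟⁿ(Y, Γ_Q) → Ȟⁿ(X, Γ_P)`: the direct limit of the maps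
`Ȟⁿ(𝓤, Γ_Q) → Ȟⁿ(φ⁻¹(𝓤), Γ_P)`. -/
def cechCohomologyMap (α : P.Hom Q) (n : ℕ) : cechCohomology Q n ⟶ cechCohomology P n :=
  colimit.desc (coverCohomologyFunctor Q n)
    { pt := cechCohomology P n
      ι :=
        { app := fun 𝓤 => coverMap α (refines_preimageCover α 𝓤) n ≫ cechι P n (preimageCover α 𝓤)
          naturality := fun 𝓤 𝓤' f => by
            have h : RefinesPreimage α 𝓤 (preimageCover α 𝓤') := by
              rintro _ ⟨U', hU', rfl⟩
              obtain ⟨U, hU, hle⟩ := leOfHom f U' hU'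
              exact ⟨U, hU, fun _ hx => hle hx⟩
            refine Eq.trans ?_ (Category.comp_id _).symm
            refine (Category.assoc (coverMap (CechPair.Hom.id Q) (leOfHom f) n) _ _).symm.trans ?_
            rw [coverMap_comp (isComp_id_right α) (leOfHom f) (refines_preimageCover α 𝓤') h,
              ← cech_w n h.preimageCover_le]
            exact (congrArg (· ≫ cechι P n _) (coverMap_comp (isComp_id_left α)
              (refines_preimageCover α 𝓤) h.preimageCover_le h n).symm).trans
              (Category.assoc _ _ _) } }

theorem cechι_map (α : P.Hom Q) (n : ℕ) {𝓤 : Cover Q.basis ⊤} {𝓥 : Cover P.basis ⊤}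
    (h : RefinesPreimage α 𝓤 𝓥) :
    cechι Q n 𝓤 ≫ cechCohomologyMap α n = coverMap α h n ≫ cechι P n 𝓥 := by
  refine (colimit.ι_desc _ _).trans ?_
  change coverMap α _ n ≫ cechι P n _ = _
  rw [← cech_w n h.preimageCover_le]
  exact (Category.assoc _ _ _).symm.trans (congrArg (· ≫ cechι P n _)
    (coverMap_comp (isComp_id_left α) (refines_preimageCover α 𝓤) h.preimageCover_le h n))

theorem cechCohomologyMap_id {α : P.Hom P} (hα : IsId α) (n : ℕ) :
    cechCohomologyMap α n = 𝟙 _ := by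
  refine cech_hom_ext n fun 𝓤 => ?_
  have h : RefinesPreimage α 𝓤 𝓤 := fun V hV => ⟨V, hV, by rw [hα.toMap_eq]; exact le_rfl⟩
  rw [cechι_map α n h, coverMap_self hα, Category.id_comp, Category.comp_id]

theorem cechCohomologyMap_comp {α : P.Hom Q} {β : Q.Hom S} {γ : P.Hom S} (hc : IsComp α β γ)
    (n : ℕ) : cechCohomologyMap β n ≫ cechCohomologyMap α n = cechCohomologyMap γ n := by
  refine cech_hom_ext n fun 𝓤 => ?_
  have h₁ := refines_preimageCover β 𝓤
  have h₂ := refines_preimageCover α (preimageCover β 𝓤)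
  have h : RefinesPreimage γ 𝓤 (preimageCover α (preimageCover β 𝓤)) := by
    rintro _ ⟨_, ⟨U, hU, rfl⟩, rfl⟩
    exact ⟨U, hU, by rw [← hc.toMap_eq]; exact le_rfl⟩
  rw [← Category.assoc, cechι_map β n h₁, Category.assoc, cechι_map α n h₂, ← Category.assoc,
    coverMap_comp hc _ _ h, cechι_map γ n h]

end CohomologyMap

/-- A presheaf on `X`, regarded as a presheaf on the basis of all open subsets. -/
def CechPair.ofPresheaf (X : TopCat.{u}) (Γ : TopCat.Presheaf (ModuleCat.{u} R) X) :
    CechPair.{u} R where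
  space := X
  basis := OpenBasis.all X
  presheaf := restrictToBasis Γ _

/-- The data inducing `α_* : Ȟⁿ(X, Γ) → Ȟⁿ(X, Γ⁺)`: the identity of `X` and `α : Γ → (Γ⁺)_B`. -/
def plusHom (P : CechPair.{u} R) :
    (CechPair.ofPresheaf P.space (plus P.presheaf)).Hom P where
  toMap := 𝟙 _
  preimage_mem _ _ := trivial
  comap :=
    { app := fun U => (toPlus P.presheaf).app U
      naturality := fun _ _ f => (toPlus P.presheaf).naturality f }

/-- The homomorphism `Ȟⁿ(X, Γ) → Ȟⁿ(X, Γ⁺) → Ȟⁿ(X, Γ⁺⁺)` induced by `α` applied twice. -/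
def toSheafificationMap (P : CechPair.{u} R) (n : ℕ) :
    cechCohomology P n ⟶
      cechCohomology (CechPair.ofPresheaf P.space (sheafification P.presheaf)) n :=
  cechCohomologyMap (plusHom P) n ≫
    cechCohomologyMap (plusHom (CechPair.ofPresheaf P.space (plus P.presheaf))) n

/-! ## Systems of sheaves on inverse systems of spaces -/

section System

variable {I : Type u} [Preorder I]

/-- The map `φ_ij : X_j → X_i` of an inverse system, for `i ≤ j`. -/
abbrev transition (F : Iᵒᵖ ⥤ TopCat.{u}) {i j : I} (h : i ≤ j) :
    F.obj (op j) ⟶ F.obj (op i) :=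
  F.map (homOfLE h).op

theorem preimage_refl (F : Iᵒᵖ ⥤ TopCat.{u}) (i : I) (U : Opens (F.obj (op i))) :
    (Opens.map (transition F (le_refl i))).obj U = U := by
  have : transition F (le_refl i) = 𝟙 _ := F.map_id _
  rw [this]
  rfl

theorem preimage_trans (F : Iᵒᵖ ⥤ TopCat.{u}) {i j k : I} (h : i ≤ j) (h' : j ≤ k)
    (U : Opens (F.obj (op i))) :
    (Opens.map (transition F h')).obj ((Opens.map (transition F h)).obj U) =
      (Opens.map (transition F (h.trans h'))).obj U := by
  have : transition F (h.trans h') = transition F h' ≫ transition F h := F.map_comp _ _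
  rw [this]
  rfl

/-- A system of sheaves of `R`-modules on an inverse system of spaces: sheaves `Γ_i` on `X_i` and
injective maps of presheaves `f_ij : Γ_i → φ_ij Γ_j` for `i ≤ j`, with `f_ii = id` and
`f_jk f_ij = f_ik` (where `φ_ii⁻¹(U) = U` and `φ_jk⁻¹(φ_ij⁻¹(U)) = φ_ik⁻¹(U)` are identified). -/
structure SheafSystem (R : Type v) [Ring R] (F : Iᵒᵖ ⥤ TopCat.{u}) where
  sheaf (i : I) : TopCat.Sheaf (ModuleCat.{u} R) (F.obj (op i))
  map {i j : I} (h : i ≤ j) : (sheaf i).presheaf ⟶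
    (TopCat.Presheaf.pushforward _ (transition F h)).obj (sheaf j).presheaf
  injective {i j : I} (h : i ≤ j) (U : Opens (F.obj (op i))) :
    Function.Injective ((map h).app (op U))
  map_refl (i : I) (U : Opens (F.obj (op i))) :
    (map (le_refl i)).app (op U) =
      (sheaf i).presheaf.map (eqToHom (congrArg op (preimage_refl F i U).symm))
  map_trans {i j k : I} (h : i ≤ j) (h' : j ≤ k) (U : Opens (F.obj (op i))) :
    (map h).app (op U) ≫ (map h').app (op ((Opens.map (transition F h)).obj U)) =
      (map (h.trans h')).app (op U) ≫
        (sheaf k).presheaf.map (eqToHom (congrArg op (preimage_trans F h h' U).symm))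

namespace SheafSystem

variable {F : Iᵒᵖ ⥤ TopCat.{u}} (S : SheafSystem R F)

/-- The space `X_i` with the sheaf `Γ_i`. -/
def pair (i : I) : CechPair.{u} R := CechPair.ofPresheaf (F.obj (op i)) (S.sheaf i).presheaf

/-- The map `φ_ij` together with `f_ij : Γ_i → φ_ij Γ_j`. -/
def hom {i j : I} (h : i ≤ j) : (S.pair j).Hom (S.pair i) where
  toMap := transition F h
  preimage_mem _ _ := trivial
  comap :=
    { app := fun U => (S.map h).app (op U.unop.1)
      naturality := fun _ _ f =>
        (S.map h).naturality ((Subtype.mono_coe _).functor.map f.unop).op }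

theorem map_refl_apply (i : I) {U : Opens (F.obj (op i))}
    (h : U ≤ (Opens.map (transition F (le_refl i))).obj U)
    (x : (S.sheaf i).presheaf.obj (op U)) :
    (S.sheaf i).presheaf.map (homOfLE h).op ((S.map (le_refl i)).app (op U) x) = x := by
  rw [S.map_refl]
  change ((S.sheaf i).presheaf.map _ ≫ (S.sheaf i).presheaf.map _).hom x = x
  rw [← Functor.map_comp,
    Subsingleton.elim (eqToHom _ ≫ (homOfLE _).op) (𝟙 (op U)), CategoryTheory.Functor.map_id]
  rfl

theorem isId_hom (i : I) : IsId (S.hom (le_refl i)) where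
  toMap_eq := F.map_id _
  ev_eq h x := S.map_refl_apply i h x

theorem isComp_hom {i j k : I} (h : i ≤ j) (h' : j ≤ k) :
    IsComp (S.hom h') (S.hom h) (S.hom (h.trans h')) where
  toMap_eq := (F.map_comp _ _).symm
  ev_eq {U V W} hV hW hW' x := by
    refine ((S.hom h').ev_res (U := ⟨(Opens.map (transition F h)).obj U.1, trivial⟩)
      hW hV ((S.map h).app (op U.1) x)).trans ?_
    change (S.sheaf k).presheaf.map (homOfLE _).op
      ((S.map h').app (op ((Opens.map (transition F h)).obj U.1)) ((S.map h).app (op U.1) x)) =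
      (S.sheaf k).presheaf.map (homOfLE hW').op ((S.map (h.trans h')).app (op U.1) x)
    have := congrArg (fun f => f.hom x) (S.map_trans h h' U.1)
    refine (congrArg _ this).trans ?_
    change ((S.sheaf k).presheaf.map _ ≫ (S.sheaf k).presheaf.map _).hom _ = _
    rw [← Functor.map_comp]
    rfl

/-- The direct system `{Ȟⁿ(X_i, Γ_i), h_ij}`. -/
def cohomologySystem (n : ℕ) : I ⥤ ModuleCat.{u} R where
  obj i := cechCohomology (S.pair i) n
  map f := cechCohomologyMap (S.hom (leOfHom f)) n
  map_id i := cechCohomologyMap_id (S.isId_hom i) n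
  map_comp f g := (cechCohomologyMap_comp (S.isComp_hom (leOfHom f) (leOfHom g)) n).symm

/-- The direct system `{φ_ij Γ_j : i ≤ j}` of presheaves on `X_i`. -/
def pushforwardSystem (i : I) :
    Set.Ici i ⥤ TopCat.Presheaf (ModuleCat.{u} R) (F.obj (op i)) where
  obj j := (TopCat.Presheaf.pushforward _ (transition F j.2)).obj (S.sheaf j.1).presheaf
  map {j k} f :=
    { app := fun U =>
        (S.map (leOfHom f)).app (op ((Opens.map (transition F j.2)).obj U.unop)) ≫
          (S.sheaf k.1).presheaf.map
            (eqToHom (congrArg op (preimage_trans F j.2 (leOfHom f) U.unop)))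
      naturality := fun U V g => by
        have := (S.map (leOfHom f)).naturality ((Opens.map (transition F j.2)).map g.unop).op
        refine (Category.assoc _ _ _).symm.trans ((congrArg (· ≫ _) this).trans ?_)
        refine (Category.assoc _ _ _).trans (Eq.trans ?_ (Category.assoc _ _ _).symm)
        refine congrArg (_ ≫ ·) ?_
        exact ((S.sheaf k.1).presheaf.map_comp _ _).symm.trans
          ((S.sheaf k.1).presheaf.map_comp
            (eqToHom (congrArg op (preimage_trans F j.2 (leOfHom f) U.unop)))
            ((Opens.map (transition F k.2)).op.map g)) }
  map_id j := by
    refine NatTrans.ext (funext fun U => ?_)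
    change (S.map (le_refl j.1)).app _ ≫ _ = 𝟙 _
    rw [S.map_refl, ← Functor.map_comp, eqToHom_trans, eqToHom_refl, CategoryTheory.Functor.map_id]
  map_comp {j k l} f g := by
    refine NatTrans.ext (funext fun U => ?_)
    have hjk : j.1 ≤ k.1 := leOfHom f
    have hkl : k.1 ≤ l.1 := leOfHom g
    have e₁ := S.map_trans hjk hkl ((Opens.map (transition F j.2)).obj U.unop)
    have e₂ := (S.map hkl).naturality
      (eqToHom (congrArg op (preimage_trans F j.2 hjk U.unop)))
    change (S.map (hjk.trans hkl)).app _ ≫ (S.sheaf l.1).presheaf.map _ =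
      ((S.map hjk).app _ ≫ (S.sheaf k.1).presheaf.map _) ≫
        ((S.map hkl).app _ ≫ (S.sheaf l.1).presheaf.map _)
    refine Eq.trans ?_ (Category.assoc _ _ _).symm
    refine Eq.trans ?_ (congrArg (_ ≫ ·) (Category.assoc _ _ _))
    refine Eq.trans ?_ (congrArg (fun q => _ ≫ q ≫ _) e₂.symm)
    refine Eq.trans ?_ (congrArg (_ ≫ ·) (Category.assoc _ _ _).symm)
    refine Eq.trans ?_ (Category.assoc _ _ _)
    refine Eq.trans ?_ (congrArg (· ≫ _) e₁.symm)
    refine Eq.trans ?_ (Category.assoc _ _ _).symm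
    refine congrArg (_ ≫ ·) ?_
    refine Eq.trans ?_ (congrArg (_ ≫ ·) ((S.sheaf l.1).presheaf.map_comp
      ((Opens.map (transition F hkl)).op.map (eqToHom _)) (eqToHom _)))
    exact (S.sheaf l.1).presheaf.map_comp
      (eqToHom (congrArg op (preimage_trans F hjk hkl _).symm)) (_ ≫ _)

variable {c : Cone F}

/-- The projection `φ_i : X → X_i`. -/
abbrev proj (c : Cone F) (i : I) : c.pt ⟶ F.obj (op i) := c.π.app (op i)

theorem preimage_proj (c : Cone F) {i j : I} (h : i ≤ j) (U : Opens (F.obj (op i))) :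
    (Opens.map (proj c j)).obj ((Opens.map (transition F h)).obj U) =
      (Opens.map (proj c i)).obj U := by
  have : proj c j ≫ transition F h = proj c i := c.w (homOfLE h).op
  rw [← this]
  rfl

/-- The basis `{φ_i⁻¹(U) | i ∈ I, U ⊆ X_i open}` of the limit of an inverse system of spaces
indexed by a (nonempty) directed set. -/
def standardBasis [IsDirectedOrder I] [Nonempty I] (hc : IsLimit c) : OpenBasis c.pt where
  carrier := {V | ∃ (i : I) (U : Opens (F.obj (op i))), (Opens.map (proj c i)).obj U = V}
  isBasis := by
    have h := TopCat.isTopologicalBasis_cofiltered_limit F c hc (fun _ => {U | IsOpen U})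
      (fun _ => TopologicalSpace.isTopologicalBasis_opens) (fun _ => isOpen_univ)
      (fun _ _ _ h₁ h₂ => h₁.inter h₂) (fun _ _ f _ hV => hV.preimage (F.map f).hom.continuous)
    rw [Opens.isBasis_iff_nbhd]
    intro U x hx
    obtain ⟨_, ⟨i, V, hV, rfl⟩, hxV, hVU⟩ := h.exists_subset_of_mem_open hx U.isOpen
    exact ⟨_, ⟨i.unop, ⟨V, hV⟩, rfl⟩, hxV, hVU⟩
  inf_mem := by
    rintro _ ⟨i, U, rfl⟩ _ ⟨j, V, rfl⟩
    obtain ⟨k, hik, hjk⟩ := exists_ge_ge i j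
    refine ⟨k, (Opens.map (transition F hik)).obj U ⊓ (Opens.map (transition F hjk)).obj V, ?_⟩
    rw [← preimage_proj c hik, ← preimage_proj c hjk]
    rfl

variable [IsDirectedOrder I] [Nonempty I]

/-- The functor `U ↦ φ_i⁻¹(U)` from the open sets of `X_i` to the standard basis of `X`. -/
def projPreimage (hc : IsLimit c) (i : I) :
    Opens (F.obj (op i)) ⥤ (standardBasis hc).carrier where
  obj U := ⟨(Opens.map (proj c i)).obj U, i, U, rfl⟩
  map f := homOfLE ((Opens.map (proj c i)).map f).le

/-- A presheaf `Γ` on the standard basis of the limit, with maps of presheaves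
`f_i : Γ_i → φ_i Γ` such that `f_j f_ij = f_i` for `i ≤ j`. -/
structure PartialPresheaf (hc : IsLimit c) where
  presheaf : BasisPresheaf R (standardBasis hc)
  map (i : I) : (S.sheaf i).presheaf ⟶ (projPreimage hc i).op ⋙ presheaf
  map_map {i j : I} (h : i ≤ j) (U : Opens (F.obj (op i))) :
    (S.map h).app (op U) ≫ (map j).app (op ((Opens.map (transition F h)).obj U)) ≫
      presheaf.res (U := (projPreimage hc j).obj ((Opens.map (transition F h)).obj U))
        (V := (projPreimage hc i).obj U) (preimage_proj c h U).ge =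
    (map i).app (op U)

/-- The maps `f_j : φ_ij Γ_j → φ_i Γ`, for `j ≥ i`, as a cocone on the direct system
`{φ_ij Γ_j : i ≤ j}`. -/
def PartialPresheaf.cocone {S : SheafSystem R F} {hc : IsLimit c} (L : S.PartialPresheaf hc)
    (i : I) : Cocone (S.pushforwardSystem i) where
  pt := (projPreimage hc i).op ⋙ L.presheaf
  ι :=
    { app := fun j =>
        { app := fun U =>
            (L.map j.1).app (op ((Opens.map (transition F j.2)).obj U.unop)) ≫
              L.presheaf.res
                (U := (projPreimage hc j.1).obj ((Opens.map (transition F j.2)).obj U.unop))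
                (V := (projPreimage hc i).obj U.unop) (preimage_proj c j.2 U.unop).ge
          naturality := fun U V g => by
            have := (L.map j.1).naturality ((Opens.map (transition F j.2)).map g.unop).op
            refine (Category.assoc _ _ _).symm.trans ((congrArg (· ≫ _) this).trans ?_)
            refine (Category.assoc _ _ _).trans (Eq.trans ?_ (Category.assoc _ _ _).symm)
            refine congrArg (_ ≫ ·) ?_
            exact (L.presheaf.map_comp _ _).symm.trans
              (L.presheaf.map_comp _ ((projPreimage hc i).op.map g)) }
      naturality := fun j k f => by
        refine NatTrans.ext (funext fun U => ?_)
        have hjk : j.1 ≤ k.1 := leOfHom f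
        have e₁ := L.map_map hjk ((Opens.map (transition F j.2)).obj U.unop)
        have e₂ := (L.map k.1).naturality
          (eqToHom (congrArg op (preimage_trans F j.2 hjk U.unop)))
        refine Eq.trans ?_ (Category.comp_id _).symm
        change ((S.map hjk).app _ ≫ (S.sheaf k.1).presheaf.map _) ≫
          (L.map k.1).app _ ≫ _ = (L.map j.1).app _ ≫ _
        rw [← e₁]
        refine (Category.assoc _ _ _).trans (Eq.trans ?_ (Category.assoc _ _ _).symm)
        refine congrArg (_ ≫ ·) ?_
        refine (Category.assoc _ _ _).symm.trans ((congrArg (· ≫ _) e₂).trans ?_)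
        refine (Category.assoc _ _ _).trans (Eq.trans ?_ (Category.assoc _ _ _).symm)
        refine congrArg (_ ≫ ·) ?_
        exact (L.presheaf.map_comp ((projPreimage hc k.1).op.map _) _).symm.trans
          (L.presheaf.map_comp
            (homOfLE (show (projPreimage hc j.1).obj ((Opens.map (transition F j.2)).obj U.unop) ≤
              (projPreimage hc k.1).obj ((Opens.map (transition F hjk)).obj
                ((Opens.map (transition F j.2)).obj U.unop)) from
              (preimage_proj c hjk _).ge)).op
            (homOfLE (show (projPreimage hc i).obj U.unop ≤
              (projPreimage hc j.1).obj ((Opens.map (transition F j.2)).obj U.unop) from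
              (preimage_proj c j.2 U.unop).ge)).op) }

/-- A limiting partial presheaf of a system of sheaves: a presheaf `Γ` on the standard basis of
the limit with maps `f_i : Γ_i → φ_i Γ` such that `f_j f_ij = f_i` and such that, for each `i`,
`φ_i Γ` is the direct limit of the `φ_ij Γ_j`, `j ≥ i`, with the canonical maps `f_j`. -/
structure LimitingPartialPresheaf (hc : IsLimit c) extends S.PartialPresheaf hc where
  isColimit (i : I) : Nonempty (IsColimit (toPartialPresheaf.cocone i))

variable {S} {hc : IsLimit c}

namespace LimitingPartialPresheaf

variable (L : S.LimitingPartialPresheaf hc)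

/-- The space `X` with its standard basis and the limiting partial presheaf. -/
def pair : CechPair.{u} R where
  space := c.pt
  basis := standardBasis hc
  presheaf := L.presheaf

/-- The projection `φ_i` together with `f_i : Γ_i → φ_i Γ`. -/
def hom (i : I) : L.pair.Hom (S.pair i) where
  toMap := proj c i
  preimage_mem U _ := ⟨i, U, rfl⟩
  comap :=
    { app := fun U => (L.map i).app (op U.unop.1)
      naturality := fun _ _ f =>
        (L.map i).naturality ((Subtype.mono_coe _).functor.map f.unop).op }

theorem isComp_hom {i j : I} (h : i ≤ j) : IsComp (L.hom j) (S.hom h) (L.hom i) where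
  toMap_eq := c.w (homOfLE h).op
  ev_eq {U V W} hV hW hW' x := by
    refine ((L.hom j).ev_res (U := ⟨(Opens.map (transition F h)).obj U.1, trivial⟩)
      hW hV ((S.map h).app (op U.1) x)).trans ?_
    have := congrArg (fun f => L.presheaf.res (U := (projPreimage hc i).obj U.1) (V := W) hW'
      (f.hom x)) (L.map_map h U.1)
    refine Eq.trans ?_ this
    exact (L.presheaf.res_res
      (U := (projPreimage hc j).obj ((Opens.map (transition F h)).obj U.1))
      (V := (projPreimage hc i).obj U.1) (W := W) (preimage_proj c h U.1).ge hW' _).symm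

/-- The limiting sheaf `Γ̂ = Γ⁺⁺` (its underlying presheaf; Čech cohomology only depends on that). -/
def limitingSheaf : TopCat.Presheaf (ModuleCat.{u} R) c.pt := sheafification L.presheaf

/-- The compatible family of the homomorphisms
`Ȟⁿ(X_i, Γ_i) → Ȟⁿ(X, Γ) → Ȟⁿ(X, Γ̂)`, the first induced by `φ_i` and `f_i` and the second
by `Γ → Γ̂`. -/
def cohomologyCocone (n : ℕ) : Cocone (S.cohomologySystem n) where
  pt := cechCohomology (CechPair.ofPresheaf c.pt L.limitingSheaf) n
  ι :=
    { app := fun i => cechCohomologyMap (L.hom i) n ≫ toSheafificationMap L.pair n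
      naturality := fun i j f => by
        refine Eq.trans ?_ (Category.comp_id _).symm
        exact (Category.assoc _ _ _).symm.trans (congrArg (· ≫ toSheafificationMap L.pair n)
          (cechCohomologyMap_comp (L.isComp_hom (leOfHom f)) n)) }

/-- The canonical homomorphism `lim→ Ȟⁿ(X_i, Γ_i) → Ȟⁿ(X, Γ̂)`. -/
def continuityMap (n : ℕ) :
    colimit (S.cohomologySystem n) ⟶
      cechCohomology (CechPair.ofPresheaf c.pt L.limitingSheaf) n :=
  colimit.desc (S.cohomologySystem n) (L.cohomologyCocone n)

end LimitingPartialPresheaf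

end SheafSystem

end System

end CechContinuity

end

universe w

noncomputable section

namespace CechContinuity

variable {R : Type v} [Ring R]

/-! ## Elements of filtered colimits and of homology modules -/

/-! On a compact space, cochains for fine enough covers consist of finitely many pieces of data, and
each piece, being an element of a filtered colimit, already lives at a finite stage.

Call a direct system of pairs (space, presheaf) approximating for a pair `P` if, after refining
covers and enlarging the index, every cochain of `P` lifts to some stage, and every cochain of a
stage whose image in `P` is zero becomes zero at a later stage (`ApproximatingSystem`). For such a
system the Čech cohomology of `P` is the direct limit of that of the stages. For surjectivity, lift
a cocycle; the differential of the lift maps to zero, hence vanishes later, so the lift becomes a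
cocycle (`exists_map_proj_eq`). For injectivity, if the image of a cocycle bounds a cochain, lift
that cochain; the cocycle minus the differential of the lift maps to zero, hence vanishes later
(`exists_map_hom_eq_zero`).

This criterion is applied in two situations. The pairs `(X_i, Γ_i)` approximate `(X, Γ)`: by
compactness a cover by members of the standard basis is refined by the preimage of a finite cover of
one `X_j`, and the finitely many values of a cochain lift to one common stage because `φ_i Γ` is a
direct limit. The constant system `(X, Γ)` approximates `(X, Γ⁺)`: sections of `Γ⁺` come locally
from `Γ`, and sections of `Γ` that die in `Γ⁺` are locally zero. Passing from such local statements
to one about all intersections of a cover is a shrinking argument on a compact Hausdorff space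
(`exists_refinement_of_locally`); empty intersections escape it and are handled by `Γ(∅) = 0`. Used
for `Γ` and then for `Γ⁺`, this identifies the cohomologies of `Γ` and `Γ⁺⁺`.

For existence, `Γ(W)` is the direct limit of the `Γ_i(U)` over all `(i, U)` with `W ⊆ φ_i⁻¹(U)`.
When `W = φ_i⁻¹(U)` the pairs `(j, φ_ij⁻¹(U))` are final among these, because the projections are
surjective; this is a compactness statement about the inverse limit (`surjective_proj`). -/

instance forget_preservesFilteredColimits :
    PreservesFilteredColimits (forget (ModuleCat.{u} R)) where
  preserves_filtered_colimits J _ _ :=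
    have : PreservesColimitsOfShape J (forget₂ (ModuleCat.{u} R) AddCommGrpCat.{u}) := ⟨inferInstance⟩
    comp_preservesColimitsOfShape (forget₂ (ModuleCat.{u} R) AddCommGrpCat.{u})
      (forget AddCommGrpCat.{u})

/-! ### Homology classes represented by cycles -/

section Represents

variable {ι : Type*} {c : ComplexShape ι} (K : HomologicalComplex (ModuleCat.{u} R) c)

/-- The chain `f` is a cycle which represents the homology class `x`. -/
def Represents {n : ι} (f : K.X n) (x : K.homology n) : Prop :=
  ∃ z : K.cycles n, K.iCycles n z = f ∧ K.homologyπ n z = x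

variable {K}

theorem exists_represents {n : ι} (x : K.homology n) : ∃ f, Represents K f x := by
  obtain ⟨z, hz⟩ := (ModuleCat.epi_iff_surjective (K.homologyπ n)).1 inferInstance x
  exact ⟨_, z, rfl, hz⟩

theorem Represents.d_eq_zero {n : ι} {f : K.X n} {x : K.homology n} (h : Represents K f x)
    (m : ι) : K.d n m f = 0 := by
  obtain ⟨z, rfl, rfl⟩ := h
  rw [← ConcreteCategory.comp_apply, K.iCycles_d]
  rfl

theorem represents_of_d_eq_zero {n : ι} (f : K.X n) (h : ∀ m, K.d n m f = 0) :
    ∃ x, Represents K f x := by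
  let k : ModuleCat.of R (LinearMap.ker (K.d n (c.next n)).hom) ⟶ K.X n :=
    ModuleCat.ofHom (Submodule.subtype _)
  have hk : k ≫ K.d n (c.next n) = 0 := ModuleCat.hom_ext <| LinearMap.ext fun y => y.2
  refine ⟨_, K.liftCycles k _ rfl hk ⟨f, h _⟩, ?_, rfl⟩
  rw [← ConcreteCategory.comp_apply, K.liftCycles_i]
  rfl

/-- Homology is the cokernel of the map from chains to cycles. The degree `m` is left free, since
differentials outside the complex shape are zero; in a cochain complex this covers degree 0 without
a case distinction. -/
theorem Represents.eq_zero_iff {n : ι} {f : K.X n} {x : K.homology n} (h : Represents K f x) :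
    x = 0 ↔ ∃ (m : ι) (g : K.X m), K.d m n g = f := by
  obtain ⟨z, rfl, rfl⟩ := h
  constructor
  · intro hx
    have hex := ShortComplex.exact_of_g_is_cokernel
      (ShortComplex.mk _ _ (K.toCycles_comp_homologyπ (c.prev n) n))
      (K.homologyIsCokernel _ n rfl)
    obtain ⟨g, hg⟩ := (ShortComplex.moduleCat_exact_iff _).1 hex z hx
    refine ⟨_, g, ?_⟩
    rw [← K.toCycles_i, ConcreteCategory.comp_apply]
    exact congrArg _ hg
  · rintro ⟨m, g, hg⟩
    have : z = K.toCycles m n g := by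
      apply (ModuleCat.mono_iff_injective (K.iCycles n)).1 inferInstance
      rw [← hg, ← ConcreteCategory.comp_apply, K.toCycles_i]
    rw [this, ← ConcreteCategory.comp_apply, K.toCycles_comp_homologyπ]
    rfl

theorem Represents.unique {n : ι} {f : K.X n} {x y : K.homology n} (h : Represents K f x)
    (h' : Represents K f y) : x = y := by
  obtain ⟨z, rfl, rfl⟩ := h
  obtain ⟨z', hz, rfl⟩ := h'
  rw [(ModuleCat.mono_iff_injective (K.iCycles n)).1 inferInstance hz]

theorem Represents.map {K' : HomologicalComplex (ModuleCat.{u} R) c} (φ : K ⟶ K') {n : ι}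
    {f : K.X n} {x : K.homology n} (h : Represents K f x) :
    Represents K' (φ.f n f) (HomologicalComplex.homologyMap φ n x) := by
  obtain ⟨z, rfl, rfl⟩ := h
  refine ⟨HomologicalComplex.cyclesMap φ n z, ?_, ?_⟩
  · simp only [← ConcreteCategory.comp_apply, HomologicalComplex.cyclesMap_i]
  · simp only [← ConcreteCategory.comp_apply, HomologicalComplex.homologyπ_naturality]

end Represents

/-! ## Covers -/

/-- The common refinement `{U ∩ V}` of two covers. -/
def Cover.inf {X : TopCat.{u}} {B : OpenBasis X} {W : Opens X} (𝓤 𝓥 : Cover B W) : Cover B W where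
  carrier := {T | ∃ U ∈ 𝓤.carrier, ∃ V ∈ 𝓥.carrier, U ⊓ V = T}
  subset := by
    rintro _ ⟨U, hU, V, hV, rfl⟩
    exact B.inf_mem _ (𝓤.subset hU) _ (𝓥.subset hV)
  sSup_eq := by
    apply le_antisymm
    · rintro x hx
      obtain ⟨_, ⟨U, hU, V, hV, rfl⟩, hx⟩ := Opens.mem_sSup.1 hx
      rw [← 𝓤.sSup_eq]
      exact Opens.mem_sSup.2 ⟨U, hU, hx.1⟩
    · intro x hx
      obtain ⟨U, hU, hxU⟩ := Opens.mem_sSup.1 (𝓤.sSup_eq.symm ▸ hx)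
      obtain ⟨V, hV, hxV⟩ := Opens.mem_sSup.1 (𝓥.sSup_eq.symm ▸ hx)
      exact Opens.mem_sSup.2 ⟨_, ⟨U, hU, V, hV, rfl⟩, hxU, hxV⟩

/-- Together with nonemptiness this makes the covers a filtered category, so an element of a colimit
over covers has a representative on a single cover, and two representatives of the same element
agree on a finer one. -/
instance {X : TopCat.{u}} (B : OpenBasis X) (W : Opens X) : IsDirectedOrder (Cover B W) where
  directed 𝓤 𝓥 := ⟨𝓤.inf 𝓥, by rintro _ ⟨U, hU, V, hV, rfl⟩; exact ⟨U, hU, inf_le_left⟩,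
    by rintro _ ⟨U, hU, V, hV, rfl⟩; exact ⟨V, hV, inf_le_right⟩⟩

instance {X : TopCat.{u}} (B : OpenBasis X) (W : Opens X) : Nonempty (Cover B W) :=
  ⟨{ carrier := {U | U ∈ B.carrier ∧ U ≤ W}
     subset _ hU := hU.1
     sSup_eq := by
      refine le_antisymm (sSup_le fun _ h => h.2) fun x hx => ?_
      obtain ⟨U, hU, hxU, hUW⟩ := Opens.isBasis_iff_nbhd.1 B.isBasis hx
      exact Opens.mem_sSup.2 ⟨U, ⟨hU, hUW⟩, hxU⟩ }⟩

theorem Cover.exists_mem {X : TopCat.{u}} {B : OpenBasis X} {W : Opens X} (𝓤 : Cover B W)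
    {x : X} (hx : x ∈ W) : ∃ U ∈ 𝓤.carrier, x ∈ U :=
  Opens.mem_sSup.1 (𝓤.sSup_eq.symm ▸ hx)

/-! ## Čech cohomology classes -/

section Classes

variable {P Q S : CechPair.{u} R}

/-- The `n`-cochains of a cover. -/
abbrev Cochain (P : CechPair.{u} R) (𝓤 : Cover P.basis ⊤) (n : ℕ) :=
  ∀ t : Fin (n + 1) → 𝓤.carrier, P.presheaf.obj (op (Cover.inter t))

/-- The differential `Cᵐ(𝓤, Γ) → Cⁿ(𝓤, Γ)`, which vanishes unless `n = m + 1`. -/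
def cochainD (𝓤 : Cover P.basis ⊤) (m n : ℕ) : Cochain P 𝓤 m →ₗ[R] Cochain P 𝓤 n :=
  ((cechComplex P 𝓤).d m n).hom

/-- The pullback of cochains along `α` and `l`. -/
def pullback (α : P.Hom Q) {𝓤 : Cover Q.basis ⊤} {𝓥 : Cover P.basis ⊤} (l : 𝓥.carrier → 𝓤.carrier)
    (hl : ∀ V, V.1 ≤ (Opens.map α.toMap).obj (l V).1) (n : ℕ) :
    Cochain Q 𝓤 n →ₗ[R] Cochain P 𝓥 n :=
  ((cechComplexMap α l hl).f n).hom

theorem pullback_d (α : P.Hom Q) {𝓤 : Cover Q.basis ⊤} {𝓥 : Cover P.basis ⊤}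
    (l : 𝓥.carrier → 𝓤.carrier) (hl : ∀ V, V.1 ≤ (Opens.map α.toMap).obj (l V).1) {m n : ℕ}
    (f : Cochain Q 𝓤 m) :
    pullback α l hl n (cochainD 𝓤 m n f) = cochainD 𝓥 m n (pullback α l hl m f) :=
  (congrArg (fun φ => φ.hom f) ((cechComplexMap α l hl).comm m n)).symm

/-- The cochain `f` is a cocycle which represents the Čech cohomology class `x`. -/
def IsClass (𝓤 : Cover P.basis ⊤) {n : ℕ} (f : Cochain P 𝓤 n) (x : cechCohomology P n) : Prop :=
  ∃ y : coverCohomology P 𝓤 n, Represents (cechComplex P 𝓤) (n := n) f y ∧ cechι P n 𝓤 y = x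

theorem exists_isClass {n : ℕ} (x : cechCohomology P n) :
    ∃ (𝓤 : Cover P.basis ⊤) (f : Cochain P 𝓤 n), IsClass 𝓤 f x := by
  obtain ⟨𝓤, y, rfl⟩ := Concrete.colimit_exists_rep (coverCohomologyFunctor P n) x
  obtain ⟨f, hf⟩ := exists_represents y
  exact ⟨𝓤, f, y, hf, rfl⟩

theorem IsClass.unique {𝓤 : Cover P.basis ⊤} {n : ℕ} {f : Cochain P 𝓤 n}
    {x x' : cechCohomology P n} (h : IsClass 𝓤 f x) (h' : IsClass 𝓤 f x') : x = x' := by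
  obtain ⟨y, hy, rfl⟩ := h
  obtain ⟨y', hy', rfl⟩ := h'
  rw [hy.unique hy']

theorem IsClass.d_eq_zero {𝓤 : Cover P.basis ⊤} {n : ℕ} {f : Cochain P 𝓤 n}
    {x : cechCohomology P n} (h : IsClass 𝓤 f x) (m : ℕ) : cochainD 𝓤 n m f = 0 := by
  obtain ⟨y, hy, rfl⟩ := h
  exact hy.d_eq_zero m

theorem exists_isClass_of_d_eq_zero {𝓤 : Cover P.basis ⊤} {n : ℕ} (f : Cochain P 𝓤 n)
    (h : ∀ m, cochainD 𝓤 n m f = 0) : ∃ x, IsClass 𝓤 f x :=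
  have ⟨y, hy⟩ := represents_of_d_eq_zero (K := cechComplex P 𝓤) f h
  ⟨_, y, hy, rfl⟩

/-- Any index map `l` may be used, because two choices give homotopic cochain maps (`coverMap_eq`).
This freedom lets the later arguments compose refinement maps explicitly and compare cochains rather
than classes. -/
theorem IsClass.pullback {𝓤 : Cover Q.basis ⊤} {n : ℕ} {f : Cochain Q 𝓤 n}
    {x : cechCohomology Q n} (h : IsClass 𝓤 f x) (α : P.Hom Q) {𝓥 : Cover P.basis ⊤}
    (l : 𝓥.carrier → 𝓤.carrier) (hl : ∀ V, V.1 ≤ (Opens.map α.toMap).obj (l V).1) :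
    IsClass 𝓥 (pullback α l hl n f) (cechCohomologyMap α n x) := by
  obtain ⟨y, hy, rfl⟩ := h
  refine ⟨_, hy.map (cechComplexMap α l hl), ?_⟩
  have hr : RefinesPreimage α 𝓤 𝓥 := fun V hV => ⟨_, (l ⟨V, hV⟩).2, hl ⟨V, hV⟩⟩
  have := congrArg (fun φ => φ.hom y) (cechι_map α n hr)
  rw [coverMap_eq α hr n l hl] at this
  exact this.symm

theorem IsClass.eq_zero_of_eq_d {𝓤 : Cover P.basis ⊤} {n : ℕ} {f : Cochain P 𝓤 n}
    {x : cechCohomology P n} (h : IsClass 𝓤 f x) {m : ℕ} {g : Cochain P 𝓤 m}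
    (hg : cochainD 𝓤 m n g = f) : x = 0 := by
  obtain ⟨y, hy, rfl⟩ := h
  rw [hy.eq_zero_iff.2 ⟨m, g, hg⟩]
  exact map_zero (cechι P n 𝓤).hom

/-- A class that vanishes in the filtered colimit already vanishes on some finer cover. -/
theorem IsClass.exists_eq_d {𝓤 : Cover P.basis ⊤} {n : ℕ} {f : Cochain P 𝓤 n}
    (h : IsClass 𝓤 f 0) :
    ∃ (𝓥 : Cover P.basis ⊤) (l : 𝓥.carrier → 𝓤.carrier) (hl : ∀ V, V.1 ≤ (l V).1) (m : ℕ)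
      (g : Cochain P 𝓥 m), cochainD 𝓥 m n g = CechContinuity.pullback (.id P) l hl n f := by
  obtain ⟨y, hy, hy0⟩ := h
  obtain ⟨𝓥, i, j, hij⟩ := Concrete.colimit_exists_of_rep_eq (coverCohomologyFunctor P n)
    (i := 𝓤) (j := 𝓤) y 0 (hy0.trans (map_zero _).symm)
  rw [map_zero] at hij
  choose l hl hl' using leOfHom i
  refine ⟨𝓥, fun V => ⟨l V.1 V.2, hl _ _⟩, fun V => hl' _ _, ?_⟩
  have := coverMap_eq (.id P) (leOfHom i) n (fun V => ⟨l V.1 V.2, hl _ _⟩) (fun V => hl' _ _)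
  exact (hy.map _).eq_zero_iff.1 ((congrArg (fun φ => φ.hom y) this).symm.trans hij)

end Classes

/-! ## A criterion for continuity of Čech cohomology -/

section Lifts

variable {P Q : CechPair.{u} R}

/-- A member of the preimage cover is a bare open set that does not remember which `U` it comes
from, so an index map for pulling back cochains has to be chosen. -/
theorem exists_preimageCover_section (α : P.Hom Q) (𝓤 : Cover Q.basis ⊤) :
    ∃ e : (preimageCover α 𝓤).carrier → 𝓤.carrier,
      ∀ V, (Opens.map α.toMap).obj (e V).1 = V.1 := by
  have h : ∀ V : (preimageCover α 𝓤).carrier,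
      ∃ U : 𝓤.carrier, (Opens.map α.toMap).obj U.1 = V.1 := by
    rintro ⟨_, U, hU, rfl⟩
    exact ⟨⟨U, hU⟩, rfl⟩
  choose e he using h
  exact ⟨e, he⟩

theorem cochainD_eq_zero {𝓤 : Cover P.basis ⊤} {m n : ℕ} (h : m + 1 ≠ n) :
    cochainD 𝓤 m n = 0 :=
  congrArg ModuleCat.Hom.hom ((cechComplex P 𝓤).shape m n h)

/-- The cochain `g` of `𝓥` is mapped by `α` to the pullback of the cochain `f` of `𝓤`
along `l`. -/
def Lifts (α : P.Hom Q) {𝓤 : Cover P.basis ⊤} {𝓥 : Cover Q.basis ⊤} (l : 𝓥.carrier → 𝓤.carrier)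
    {n : ℕ} (g : Cochain Q 𝓥 n) (f : Cochain P 𝓤 n) : Prop :=
  ∀ (t : Fin (n + 1) → 𝓥.carrier) (W : P.basis.carrier)
    (hW : W.1 ≤ (Opens.map α.toMap).obj (Cover.inter t).1) (hW' : W ≤ Cover.inter (l ∘ t)),
    α.ev hW (g t) = P.presheaf.res hW' (f (l ∘ t))

/-- `Lifts` compares values on every `W` contained in both relevant open sets. Hence all faces of a
tuple can be compared on the same `W`, and the alternating sums agree term by term. -/
theorem Lifts.d {α : P.Hom Q} {𝓤 : Cover P.basis ⊤} {𝓥 : Cover Q.basis ⊤}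
    {l : 𝓥.carrier → 𝓤.carrier} {m : ℕ}
    {g : Cochain Q 𝓥 m} {f : Cochain P 𝓤 m} (h : Lifts α l g f) (n : ℕ) :
    Lifts α l (cochainD 𝓥 m n g) (cochainD 𝓤 m n f) := by
  intro t W hW hW'
  by_cases hmn : m + 1 = n
  · subst hmn
    refine (congrArg (α.ev hW) (cechComplex_d_apply Q 𝓥 m g t)).trans
      (Eq.trans ?_ (congrArg (P.presheaf.res hW') (cechComplex_d_apply P 𝓤 m f (l ∘ t))).symm)
    rw [map_sum, map_sum]
    refine Finset.sum_congr rfl fun i _ => ?_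
    rw [map_zsmul, map_zsmul]
    refine congrArg _ ((α.ev_res _ _ _).trans (Eq.trans ?_ (P.presheaf.res_res _ _ _).symm))
    exact h _ _ _ _
  · rw [cochainD_eq_zero hmn, cochainD_eq_zero hmn]
    exact (map_zero (α.ev hW).hom).trans (map_zero (P.presheaf.res hW').hom).symm

end Lifts

/-- A direct system of pairs which approximates the pair `P` on the level of cochains. -/
structure ApproximatingSystem (I : Type w) [Preorder I] (P : CechPair.{u} R) where
  pair : I → CechPair.{u} R
  hom {i j : I} (h : i ≤ j) : (pair j).Hom (pair i)
  isComp_hom {i j k : I} (h : i ≤ j) (h' : j ≤ k) : IsComp (hom h') (hom h) (hom (h.trans h'))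
  proj (i : I) : P.Hom (pair i)
  isComp_proj {i j : I} (h : i ≤ j) : IsComp (proj j) (hom h) (proj i)
  surjective (i : I) : Function.Surjective (proj i).toMap
  -- Nothing is required of the differential of the lift; that a lift of a cocycle eventually
  -- becomes a cocycle follows from `exists_pullback_eq_zero`.
  exists_lifts (i : I) {n : ℕ} (𝓤 : Cover P.basis ⊤) (f : Cochain P 𝓤 n) :
    ∃ (j : I) (_ : i ≤ j) (𝓥 : Cover (pair j).basis ⊤) (l : 𝓥.carrier → 𝓤.carrier)
      (_ : ∀ V, (Opens.map (proj j).toMap).obj V.1 ≤ (l V).1) (g : Cochain (pair j) 𝓥 n),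
      Lifts (proj j) l g f
  exists_pullback_eq_zero (i : I) {n : ℕ} (𝓥 : Cover (pair i).basis ⊤)
    (g : Cochain (pair i) 𝓥 n)
    (hg : ∀ t (W : P.basis.carrier) (hW : W.1 ≤ (Opens.map (proj i).toMap).obj (Cover.inter t).1),
      (proj i).ev hW (g t) = 0) :
    ∃ (j : I) (h : i ≤ j) (𝓦 : Cover (pair j).basis ⊤) (l : 𝓦.carrier → 𝓥.carrier)
      (hl : ∀ V, V.1 ≤ (Opens.map (hom h).toMap).obj (l V).1), pullback (hom h) l hl n g = 0

/-! ### Surjectivity and injectivity for approximating systems -/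

namespace ApproximatingSystem

variable {I : Type w} [Preorder I] {P : CechPair.{u} R} (A : ApproximatingSystem I P)

theorem map_proj_map_hom {i j : I} (h : i ≤ j) (U : Opens (A.pair i).space) :
    (Opens.map (A.proj j).toMap).obj ((Opens.map (A.hom h).toMap).obj U) =
      (Opens.map (A.proj i).toMap).obj U := by
  rw [← (A.isComp_proj h).toMap_eq]
  rfl

/-- Surjectivity of the projection lets refinement relations established on the limit space descend
to a stage. -/
theorem le_of_map_proj_le (i : I) {U V : Opens (A.pair i).space}
    (h : (Opens.map (A.proj i).toMap).obj U ≤ (Opens.map (A.proj i).toMap).obj V) : U ≤ V := by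
  intro x hx
  obtain ⟨y, rfl⟩ := A.surjective i x
  exact h hx

theorem exists_map_proj_eq [Nonempty I] (n : ℕ) (x : cechCohomology P n) :
    ∃ (i : I) (y : cechCohomology (A.pair i) n), cechCohomologyMap (A.proj i) n y = x := by
  obtain ⟨𝓤, f, hf⟩ := exists_isClass x
  obtain ⟨j, -, 𝓥, l, hl, g, hg⟩ := A.exists_lifts (Classical.arbitrary I) 𝓤 f
  -- The differential of `g` lifts the differential of the cocycle `f`, so its image is zero and it
  -- vanishes at a later stage `k`.
  obtain ⟨k, hjk, 𝓦, m, hm, h0⟩ := A.exists_pullback_eq_zero j 𝓥 (cochainD 𝓥 n (n + 1) g)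
    fun t W hW => by
      have hW' : W ≤ Cover.inter (l ∘ t) := le_iInf (α := Opens P.space) fun i =>
        (hW.trans fun _ hx => inter_le t i hx).trans (hl (t i))
      rw [hg.d _ t W hW hW', hf.d_eq_zero]
      exact map_zero (P.presheaf.res hW').hom
  obtain ⟨y, hy⟩ := exists_isClass_of_d_eq_zero (pullback (A.hom hjk) m hm n g) fun k => by
    by_cases hk : n + 1 = k
    · subst hk
      rw [← pullback_d, h0]
    · rw [cochainD_eq_zero hk, LinearMap.zero_apply]
  refine ⟨k, y, ?_⟩
  obtain ⟨e, he⟩ := exists_preimageCover_section (A.proj k) 𝓦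
  -- Over the preimage of `𝓦` in the limit space, `f` restricted along `l ∘ m ∘ e` and the image of
  -- the pulled-back `g` are the same cochain, so they define the same class.
  have hle : ∀ V, V.1 ≤ (l (m (e V))).1 := fun V => by
    refine le_trans ?_ (hl _)
    rw [← A.map_proj_map_hom hjk, ← he V]
    exact fun x hx => hm (e V) hx
  have h₁ := hy.pullback (A.proj k) e fun V => (he V).ge
  have h₂ := hf.pullback (.id P) (l ∘ m ∘ e) hle
  rw [cechCohomologyMap_id (isId_id P), ConcreteCategory.id_apply] at h₂
  refine h₁.unique ?_
  convert h₂ using 1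
  funext t
  refine ((A.isComp_proj hjk).ev_eq _ _ ?_ _).trans (hg _ _ _ _)
  rw [← A.map_proj_map_hom hjk]
  exact (inter_le_map_inter _ e (fun V => (he V).ge) t).trans fun x hx =>
    inter_le_map_inter _ m hm (e ∘ t) hx

theorem exists_map_hom_eq_zero (n : ℕ) (i : I) (y : cechCohomology (A.pair i) n)
    (hy : cechCohomologyMap (A.proj i) n y = 0) :
    ∃ (j : I) (h : i ≤ j), cechCohomologyMap (A.hom h) n y = 0 := by
  obtain ⟨𝓥₀, g₀, hg₀⟩ := exists_isClass y
  obtain ⟨e, he⟩ := exists_preimageCover_section (A.proj i) 𝓥₀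
  have h₁ := hg₀.pullback (A.proj i) e fun V => (he V).ge
  rw [hy] at h₁
  obtain ⟨𝓤, r, hr, m, f, hf⟩ := h₁.exists_eq_d
  obtain ⟨j, hij, 𝓥, l, hl, g, hg⟩ := A.exists_lifts i 𝓤 f
  -- The inclusion is known only after pulling back to the limit space, through the chain `l`, `r`,
  -- `e`.
  have hp : ∀ V, V.1 ≤ (Opens.map (A.hom hij).toMap).obj (e (r (l V))).1 := fun V => by
    apply A.le_of_map_proj_le j
    rw [A.map_proj_map_hom, he]
    exact (hl V).trans (hr _)
  -- In the limit the cocycle `g₀` becomes the differential of `f`, and `g` lifts `f`; so `g₀` minus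
  -- the differential of `g` maps to zero. Once this difference vanishes at stage `k`, the class
  -- there is represented by a coboundary.
  obtain ⟨k, hjk, 𝓦, q, hq, h0⟩ := A.exists_pullback_eq_zero j 𝓥
    (pullback (A.hom hij) (e ∘ r ∘ l) hp n g₀ - cochainD 𝓥 m n g) fun t W hW => by
      have hW' : W ≤ Cover.inter (l ∘ t) := le_iInf (α := Opens P.space) fun i =>
        (hW.trans fun _ hx => inter_le t i hx).trans (hl (t i))
      have hW'' : W.1 ≤ (Opens.map (A.proj i).toMap).obj (Cover.inter (e ∘ r ∘ l ∘ t)).1 :=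
        le_map_iInf _ _ _ fun a => le_trans (le_trans (le_trans hW' (inter_le (l ∘ t) a))
          (hr _)) (he _).ge
      rw [Pi.sub_apply, map_sub, hg.d _ t W hW hW', hf, sub_eq_zero]
      refine ((A.isComp_proj hij).ev_eq _ _ hW'' _).trans ?_
      refine Eq.trans ?_ (congrArg (P.presheaf.res hW') ((A.proj i).res_ev _ _ _).symm)
      exact ((A.proj i).res_ev _ _ _).symm
  refine ⟨k, hij.trans hjk, ?_⟩
  have h₂ := (hg₀.pullback (A.hom hij) (e ∘ r ∘ l) hp).pullback (A.hom hjk) q hq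
  rw [map_sub, sub_eq_zero] at h0
  rw [h0, pullback_d] at h₂
  have := h₂.eq_zero_of_eq_d rfl
  rwa [← ConcreteCategory.comp_apply, cechCohomologyMap_comp (A.isComp_hom hij hjk)] at this

end ApproximatingSystem

/-! ## Cochains with values in `Γ` and `Γ⁺` on a compact Hausdorff space -/

theorem Cover.inter_le {X : TopCat.{u}} {B : OpenBasis X} {W : Opens X} {𝓤 : Cover B W} {n : ℕ}
    (t : Fin (n + 1) → 𝓤.carrier) (i : Fin (n + 1)) : (Cover.inter t).1 ≤ (t i).1 :=
  iInf_le (fun i => (t i).1) i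

/-- On a compact Hausdorff space, a hereditary property of tuples of members of a cover which holds
locally holds, after a refinement, on all nonempty intersections. -/
theorem exists_refinement_of_locally {X : TopCat.{u}} [CompactSpace X] [T2Space X]
    {B B' : OpenBasis X} (𝓤 : Cover B' ⊤) {n : ℕ}
    (K : (Fin (n + 1) → 𝓤.carrier) → B.carrier → Prop)
    (hmono : ∀ t V W, V ≤ W → K t W → K t V)
    (hloc : ∀ t, ∀ x ∈ (Cover.inter t).1, ∃ W : B.carrier, x ∈ W.1 ∧ K t W) :
    ∃ (𝓥 : Cover B ⊤) (l : 𝓥.carrier → 𝓤.carrier), (∀ V, V.1 ≤ (l V).1) ∧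
      ∀ t : Fin (n + 1) → 𝓥.carrier, (Cover.inter t).1 = ⊥ ∨ K (l ∘ t) (Cover.inter t) := by
  -- Regularity gives the shrinking `closure N ⊆ U`; compactness reduces the sets `N` to finitely
  -- many, indexed by `s`.
  have h₁ : ∀ x : X, ∃ (U : 𝓤.carrier) (N : Opens X), x ∈ N ∧ closure (N : Set X) ⊆ U.1 := by
    intro x
    obtain ⟨U, hU, hxU⟩ := 𝓤.exists_mem (x := x) trivial
    obtain ⟨N, hN, hNc, hNU⟩ := exists_mem_nhds_isClosed_subset (U.isOpen.mem_nhds hxU)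
    exact ⟨⟨U, hU⟩, ⟨interior N, isOpen_interior⟩, mem_interior_iff_mem_nhds.2 hN,
      (closure_minimal interior_subset hNc).trans hNU⟩
  choose U N hxN hNU using h₁
  obtain ⟨s, hs⟩ := isCompact_univ.elim_finite_subcover (fun x => (N x : Set X))
    (fun x => (N x).isOpen) fun x _ => Set.mem_iUnion.2 ⟨x, hxN x⟩
  have h₂ : ∀ x : X, ∃ a : s, x ∈ N a := fun x => by
    obtain ⟨a, ha, hxa⟩ := Set.mem_iUnion₂.1 (hs (Set.mem_univ x))
    exact ⟨⟨a, ha⟩, hxa⟩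
  choose l hl using h₂
  -- Each condition on `V` holds for all small neighbourhoods of `x`, and there are finitely many of
  -- them since `s` and the set of `(n + 1)`-tuples in `s` are finite.
  have h₃ : ∀ x : X, ∃ V : B.carrier, x ∈ V.1 ∧ V.1 ≤ N (l x) ∧
      (∀ a : s, x ∉ closure (N a : Set X) → Disjoint (V.1 : Set X) (N a)) ∧
      ∀ t : Fin (n + 1) → s, x ∈ (Cover.inter fun i => U (t i)).1 → K (fun i => U (t i)) V := by
    intro x
    have e₁ : ∀ᶠ T in (nhds x).smallSets, T ⊆ (N (l x) : Set X) :=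
      Filter.eventually_smallSets.2 ⟨_, (N (l x)).isOpen.mem_nhds (hl x), fun _ h => h⟩
    have e₂ : ∀ᶠ T in (nhds x).smallSets, ∀ a : s, x ∉ closure (N a : Set X) →
        Disjoint T (N a : Set X) := by
      refine Filter.eventually_all.2 fun a => ?_
      by_cases hx : x ∈ closure (N a : Set X)
      · exact .of_forall fun T h => absurd hx h
      · refine Filter.eventually_smallSets.2
          ⟨_, isClosed_closure.isOpen_compl.mem_nhds hx, fun T hT _ => ?_⟩
        exact Set.disjoint_left.2 fun y hy hy' => hT hy (subset_closure hy')
    have e₃ : ∀ᶠ T in (nhds x).smallSets, ∀ t : Fin (n + 1) → s,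
        x ∈ (Cover.inter fun i => U (t i)).1 →
          ∀ V : B.carrier, (V.1 : Set X) ⊆ T → K (fun i => U (t i)) V := by
      refine Filter.eventually_all.2 fun t => ?_
      by_cases hx : x ∈ (Cover.inter fun i => U (t i)).1
      · obtain ⟨W, hxW, hW⟩ := hloc _ x hx
        exact Filter.eventually_smallSets.2 ⟨_, W.1.isOpen.mem_nhds hxW,
          fun T hT _ V hV => hmono _ _ W (hV.trans hT) hW⟩
      · exact .of_forall fun T h => absurd h hx
    obtain ⟨T, hT, hT'⟩ := Filter.eventually_smallSets.1 (e₁.and (e₂.and e₃))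
    obtain ⟨T', hT'T, hT'o, hxT'⟩ := mem_nhds_iff.1 hT
    obtain ⟨V, hV, hxV, hVT⟩ := Opens.isBasis_iff_nbhd.1 B.isBasis (U := ⟨T', hT'o⟩) hxT'
    obtain ⟨p₁, p₂, p₃⟩ := hT' V fun y hy => hT'T (hVT hy)
    exact ⟨⟨V, hV⟩, hxV, p₁, p₂, fun t ht => p₃ t ht _ subset_rfl⟩
  choose V hxV hVN hVd hVK using h₃
  let 𝓥 : Cover B ⊤ :=
    { carrier := Set.range fun x => (V x).1
      subset := by rintro _ ⟨x, rfl⟩; exact (V x).2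
      sSup_eq := top_le_iff.1 fun x _ => Opens.mem_sSup.2 ⟨_, ⟨x, rfl⟩, hxV x⟩ }
  have h₄ : ∀ T : 𝓥.carrier, ∃ x, (V x).1 = T.1 := fun T => T.2
  choose p hp using h₄
  have hNU' : ∀ a, N a ≤ (U a).1 := fun a => subset_closure.trans (hNU a)
  refine ⟨𝓥, fun T => U (l (p T)), fun T => ?_, fun t => ?_⟩
  · rw [← hp T]
    exact (hVN _).trans (hNU' _)
  · refine or_iff_not_imp_left.2 fun hne => ?_
    obtain ⟨y, hy⟩ : ((Cover.inter t).1 : Set X).Nonempty := by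
      rw [Set.nonempty_iff_ne_empty]
      exact fun h => hne (Opens.ext h)
    have hy' : ∀ i, y ∈ (V (p (t i))).1 := fun i => by rw [hp]; exact Cover.inter_le t i hy
    -- The centre `x` of the first set lies in every `U` of the tuple: the common point `y` shows
    -- that `V x` meets each `N` of the tuple, so by the choice of `V x` the point `x` lies in the
    -- closure of that `N`, which is contained in `U`.
    have hmem : p (t 0) ∈ (Cover.inter fun i => U (l (p (t i)))).1 := by
      change p (t 0) ∈ ((⨅ i, (U (l (p (t i)))).1 : Opens X) : Set X)
      rw [Opens.coe_iInf]
      refine Set.mem_iInter.2 fun i => hNU _ (by_contra fun h => ?_)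
      exact Set.disjoint_left.1 (hVd _ _ h) (hy' 0) (hVN _ (hy' i))
    refine hmono _ _ _ ?_ (hVK (p (t 0)) (fun i => l (p (t i))) hmem)
    exact (Cover.inter_le t 0).trans (hp (t 0)).ge

/-! ### Sections of `Γ⁺` in terms of `Γ` -/

section Plus

variable {X : TopCat.{u}} {B : OpenBasis X} (Γ : BasisPresheaf R B)

/-- Vanishing in the colimit `Γ⁺(V)` means that the family `{γ}` becomes zero on some cover of `V`;
take a member of that cover through `x`. -/
theorem exists_res_eq_zero_of_toPlus_eq_zero {V : B.carrier} {γ : Γ.obj (op V)}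
    (h : (toPlus Γ).app (op V) γ = 0) {x : X} (hx : x ∈ V.1) :
    ∃ (U : B.carrier) (hU : U ≤ V), x ∈ U.1 ∧ Γ.res hU γ = 0 := by
  obtain ⟨𝓤, i, j, hij⟩ := Concrete.colimit_exists_of_rep_eq (familiesFunctor Γ V.1)
    (i := Cover.single V) (j := Cover.single V) (singleFamily Γ V γ) 0
    (h.trans (map_zero (plusι Γ (Cover.single V)).hom).symm)
  obtain ⟨U, hU, hxU⟩ := 𝓤.exists_mem hx
  have hUV : U ≤ V.1 := (le_sSup hU).trans 𝓤.sSup_eq.le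
  refine ⟨⟨U, 𝓤.subset hU⟩, hUV, hxU, ?_⟩
  have h₁ := refineFamilies_apply Γ (leOfHom i) (singleFamily Γ V γ) ⟨U, hU⟩ ⟨V.1, rfl⟩ hUV
  have h₂ := congrArg (fun z : compatibleFamilies Γ 𝓤 => z.1 ⟨U, hU⟩)
    (hij.trans (map_zero ((familiesFunctor Γ V.1).map j).hom))
  exact ((Γ.res_res le_rfl hUV γ).symm.trans h₁.symm).trans h₂

/-- A section of `Γ⁺` is the class of a compatible family; near `x` it is given by a member of that
family. -/
theorem exists_toPlus_eq_res {W : Opens X} (γ : (plus Γ).obj (op W)) {x : X} (hx : x ∈ W) :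
    ∃ (U : B.carrier) (hU : U.1 ≤ W) (δ : Γ.obj (op U)), x ∈ U.1 ∧
      (toPlus Γ).app (op U) δ = plusRes Γ hU γ := by
  obtain ⟨𝓤, δ, rfl⟩ := Concrete.colimit_exists_rep (familiesFunctor Γ W) γ
  obtain ⟨U, hU, hxU⟩ := 𝓤.exists_mem hx
  have hUW : U ≤ W := (le_sSup hU).trans 𝓤.sSup_eq.le
  have hr : ∀ V ∈ (Cover.single (⟨U, 𝓤.subset hU⟩ : B.carrier)).carrier, ∃ U ∈ 𝓤.carrier, V ≤ U := by
    rintro _ hV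
    exact ⟨U, hU, hV.le⟩
  refine ⟨⟨U, 𝓤.subset hU⟩, hUW, δ.1 ⟨U, hU⟩, hxU, ?_⟩
  refine Eq.trans ?_ (congrArg (fun φ => φ.hom δ) (plusι_plusRes Γ hUW 𝓤 _ hr)).symm
  refine congrArg (plusι Γ (Cover.single (⟨U, 𝓤.subset hU⟩ : B.carrier))) (Subtype.ext (funext ?_))
  rintro ⟨V, hV⟩
  obtain rfl : V = U := hV
  exact (refineFamilies_apply Γ hr δ ⟨V, rfl⟩ ⟨V, hU⟩ le_rfl).symm

/-- The empty cover of `∅` is the finest one, and it carries only the empty family. This makes the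
criterion applicable to `Γ⁺` itself, whatever `Γ(∅)` is. -/
theorem subsingleton_plus_bot : Subsingleton ((plus Γ).obj (op ⊥)) := by
  let 𝓥 : Cover B ⊥ := ⟨∅, Set.empty_subset _, sSup_empty⟩
  refine ⟨fun a b => ?_⟩
  have h : ∀ γ : (plus Γ).obj (op ⊥), γ = plusι Γ 𝓥 0 := fun γ => by
    obtain ⟨𝓤, δ, rfl⟩ := Concrete.colimit_exists_rep (familiesFunctor Γ ⊥) γ
    have h : 𝓤 ≤ 𝓥 := fun _ hV => hV.elim
    refine (congrArg (fun φ => φ.hom δ) (plus_w Γ h)).symm.trans ?_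
    refine congrArg (plusι Γ 𝓥) (Subtype.ext (funext ?_))
    rintro ⟨_, ⟨⟩⟩
  rw [h a, h b]

end Plus

theorem subsingleton_of_eq {X : TopCat.{u}} {B : OpenBasis X} (Γ : BasisPresheaf R B)
    {V W : B.carrier} (hV : V.1 = W.1) [h : Subsingleton (Γ.obj (op V))] :
    Subsingleton (Γ.obj (op W)) := by
  obtain rfl : V = W := Subtype.ext hV
  exact h

/-- On a compact Hausdorff space, `Γ⁺` is approximated by `Γ`, provided that `Γ(∅) = 0`. -/
def plusApproximatingSystem (P : CechPair.{u} R) [CompactSpace P.space] [T2Space P.space]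
    (hP : ∀ V : P.basis.carrier, V.1 = ⊥ → Subsingleton (P.presheaf.obj (op V))) :
    ApproximatingSystem PUnit.{1} (CechPair.ofPresheaf P.space (plus P.presheaf)) where
  pair _ := P
  hom _ := .id P
  isComp_hom _ _ := isComp_id_left _
  proj _ := plusHom P
  isComp_proj _ := isComp_id_right _
  surjective _ := Function.surjective_id
  exists_lifts _ n 𝓤 f := by
    let Q := CechPair.ofPresheaf P.space (plus P.presheaf)
    -- The hereditary property is that the value `f t` restricted to `W` comes from `Γ(W)`.
    obtain ⟨𝓥, l, hl, hK⟩ := exists_refinement_of_locally (B := P.basis) 𝓤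
      (fun t W => ∃ (h : W.1 ≤ (Cover.inter t).1) (δ : P.presheaf.obj (op W)),
        (toPlus P.presheaf).app (op W) δ = plusRes P.presheaf h (f t))
      (by
        rintro t V W hVW ⟨h, δ, hδ⟩
        refine ⟨le_trans (α := Opens P.space) hVW h, P.presheaf.res hVW δ, ?_⟩
        have h₁ := congrArg (fun φ => φ.hom δ) ((toPlus P.presheaf).naturality (homOfLE hVW).op)
        refine h₁.trans ((congrArg (plusRes P.presheaf (W := W.1) (W' := V.1) hVW) hδ).trans ?_)
        exact Q.presheaf.res_res (U := Cover.inter t) (V := ⟨W.1, trivial⟩) (W := ⟨V.1, trivial⟩)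
          h hVW (f t))
      (fun t x hx => by
        obtain ⟨U, hU, δ, hxU, h⟩ := exists_toPlus_eq_res P.presheaf (f t) hx
        exact ⟨U, hxU, hU, δ, h⟩)
    have hg : ∀ t : Fin (n + 1) → 𝓥.carrier, ∃ γ : P.presheaf.obj (op (Cover.inter t)),
        ∀ (W : Q.basis.carrier) (hW : W.1 ≤ (Cover.inter t).1) (hW' : W ≤ Cover.inter (l ∘ t)),
          (plusHom P).ev hW γ = Q.presheaf.res hW' (f (l ∘ t)) := by
      intro t
      rcases hK t with h | ⟨h, δ, hδ⟩
      -- On an empty intersection nothing is known about `f`, but both sides lie in `Γ⁺(∅) = 0`.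
      · refine ⟨0, fun W hW hW' => ?_⟩
        have : Subsingleton (Q.presheaf.obj (op (⟨⊥, trivial⟩ : Q.basis.carrier))) :=
          subsingleton_plus_bot P.presheaf
        have := subsingleton_of_eq Q.presheaf (V := ⟨⊥, trivial⟩) (W := W)
          (le_antisymm bot_le (hW.trans h.le))
        exact Subsingleton.elim _ _
      · refine ⟨δ, fun W hW hW' => ?_⟩
        refine (congrArg (Q.presheaf.res (U := ⟨(Cover.inter t).1, trivial⟩) hW) hδ).trans ?_
        exact Q.presheaf.res_res (U := Cover.inter (l ∘ t)) (V := ⟨(Cover.inter t).1, trivial⟩)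
          h hW (f (l ∘ t))
    choose g hg using hg
    exact ⟨⟨⟩, le_rfl, 𝓥, l, hl, g, hg⟩
  exists_pullback_eq_zero _ n 𝓤 g hg := by
    -- Here the hereditary property is that `g t` vanishes on `W`; empty intersections are covered
    -- by `hP`.
    obtain ⟨𝓥, l, hl, hK⟩ := exists_refinement_of_locally (B := P.basis) 𝓤
      (fun t W => ∃ h : W ≤ Cover.inter t, P.presheaf.res h (g t) = 0)
      (by
        rintro t V W hVW ⟨h, h'⟩
        refine ⟨hVW.trans h, ?_⟩
        rw [← P.presheaf.res_res h hVW, h', map_zero])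
      (fun t x hx => by
        have h₁ := hg t ⟨(Cover.inter t).1, trivial⟩ le_rfl
        have h₂ : (toPlus P.presheaf).app (op (Cover.inter t)) (g t) = 0 :=
          (BasisPresheaf.res_self (CechPair.ofPresheaf P.space (plus P.presheaf)).presheaf
            (U := ⟨(Cover.inter t).1, trivial⟩) le_rfl _).symm.trans h₁
        obtain ⟨U, hU, hxU, h⟩ := exists_res_eq_zero_of_toPlus_eq_zero P.presheaf h₂ hx
        exact ⟨U, hxU, hU, h⟩)
    refine ⟨⟨⟩, le_rfl, 𝓥, l, hl, funext fun t => ?_⟩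
    rcases hK t with h | ⟨h, h'⟩
    · have := hP _ h
      exact Subsingleton.elim _ _
    · exact h'

theorem isIso_cechCohomologyMap_plusHom (P : CechPair.{u} R) [CompactSpace P.space]
    [T2Space P.space]
    (hP : ∀ V : P.basis.carrier, V.1 = ⊥ → Subsingleton (P.presheaf.obj (op V))) (n : ℕ) :
    IsIso (cechCohomologyMap (plusHom P) n) := by
  let A := plusApproximatingSystem P hP
  rw [ConcreteCategory.isIso_iff_bijective]
  constructor
  · refine (injective_iff_map_eq_zero (cechCohomologyMap (plusHom P) n).hom).2 fun y hy => ?_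
    obtain ⟨_, _, h⟩ := A.exists_map_hom_eq_zero n ⟨⟩ y hy
    have h' : cechCohomologyMap (.id P) n y = 0 := h
    rwa [cechCohomologyMap_id (isId_id P)] at h'
  · intro x
    obtain ⟨_, y, hy⟩ := A.exists_map_proj_eq n x
    exact ⟨y, hy⟩

theorem isIso_toSheafificationMap (P : CechPair.{u} R) [CompactSpace P.space] [T2Space P.space]
    (hP : ∀ V : P.basis.carrier, V.1 = ⊥ → Subsingleton (P.presheaf.obj (op V))) (n : ℕ) :
    IsIso (toSheafificationMap P n) := by
  let Q := CechPair.ofPresheaf P.space (plus P.presheaf)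
  have : CompactSpace Q.space := ‹CompactSpace P.space›
  have : T2Space Q.space := ‹T2Space P.space›
  have h₁ := isIso_cechCohomologyMap_plusHom P hP n
  have h₂ := isIso_cechCohomologyMap_plusHom Q (fun V hV => by
    have : Subsingleton (Q.presheaf.obj (op (⟨⊥, trivial⟩ : Q.basis.carrier))) :=
      subsingleton_plus_bot P.presheaf
    exact subsingleton_of_eq Q.presheaf (V := ⟨⊥, trivial⟩) hV.symm) n
  exact inferInstanceAs (IsIso (cechCohomologyMap (plusHom P) n ≫ cechCohomologyMap (plusHom Q) n))

/-! ## Limits of compact Hausdorff spaces -/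

section Topology

open SheafSystem

variable {I : Type u} [Preorder I] {F : Iᵒᵖ ⥤ TopCat.{u}} {c : Cone F}

theorem t2Space_pt (hc : IsLimit c) (hT2 : ∀ i : I, T2Space (F.obj (op i))) : T2Space c.pt := by
  let e := TopCat.homeoOfIso (hc.conePointUniqueUpToIso (TopCat.limitConeIsLimit F))
  have : ∀ j, T2Space (F.obj j) := fun j => hT2 j.unop
  have : T2Space (TopCat.limitCone F).pt :=
    inferInstanceAs (T2Space { u : ∀ j, F.obj j | ∀ {i j} (f : i ⟶ j), F.map f (u i) = u j })
  exact e.symm.t2Space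

/-- The limit is the set of compatible families in the product; it is closed because the factors are
Hausdorff, so Tychonoff's theorem applies. -/
theorem compactSpace_pt (hc : IsLimit c) (hcompact : ∀ i : I, CompactSpace (F.obj (op i)))
    (hT2 : ∀ i : I, T2Space (F.obj (op i))) : CompactSpace c.pt := by
  let e := TopCat.homeoOfIso (hc.conePointUniqueUpToIso (TopCat.limitConeIsLimit F))
  have : ∀ j, T2Space (F.obj j) := fun j => hT2 j.unop
  have : ∀ j, CompactSpace (F.obj j) := fun j => hcompact j.unop
  have hcl : IsClosed { u : ∀ j, F.obj j | ∀ {i j} (f : i ⟶ j), F.map f (u i) = u j } := by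
    simp only [Set.ofPred_forall]
    refine isClosed_iInter fun i => isClosed_iInter fun j => isClosed_iInter fun f => ?_
    exact isClosed_eq ((F.map f).hom.continuous.comp (continuous_apply i)) (continuous_apply j)
  have : CompactSpace (TopCat.limitCone F).pt := isCompact_iff_compactSpace.1 hcl.isCompact
  exact e.symm.compactSpace

/-- Compatibility is imposed only below one index at a time. The families over `x` that are
compatible below `m` form a closed nonempty subset of the compact product, these subsets are
directed, and a point of their intersection is a point of the limit over `x`. -/
theorem surjective_proj [IsDirectedOrder I] (hc : IsLimit c)
    (hcompact : ∀ i : I, CompactSpace (F.obj (op i))) (hT2 : ∀ i : I, T2Space (F.obj (op i)))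
    (hsurj : ∀ {i j : I} (h : i ≤ j), Function.Surjective (transition F h)) (i : I) :
    Function.Surjective (proj c i) := by
  intro x
  have hcomp : ∀ {j k l : I} (h : j ≤ k) (h' : k ≤ l) (y : F.obj (op l)),
      transition F h (transition F h' y) = transition F (h.trans h') y := fun h h' y =>
    (congrArg (fun φ => φ.hom y) (F.map_comp (homOfLE h').op (homOfLE h).op)).symm
  let E : Set.Ici i → Set (∀ j : I, F.obj (op j)) := fun m =>
    {u | u i = x} ∩ {u | ∀ (j : I) (h : j ≤ m.1), transition F h (u m.1) = u j}
  have hne : ∀ m, (E m).Nonempty := by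
    rintro ⟨m, hm⟩
    obtain ⟨y, hy⟩ := hsurj hm x
    -- Lift `y` to a common upper bound of `m` and `j` and project down. Nonemptiness supplies the
    -- arbitrary coordinates at indices not below `m`.
    have : ∀ j : I, Nonempty (F.obj (op j)) := fun j => by
      obtain ⟨k, hk, hk'⟩ := exists_ge_ge m j
      obtain ⟨z, -⟩ := hsurj hk y
      exact ⟨transition F hk' z⟩
    classical
    have hself : transition F (le_refl m) y = y :=
      congrArg (fun φ => φ.hom y) (F.map_id (op m))
    refine ⟨fun j => if h : j ≤ m then transition F h y else Classical.arbitrary _, ?_, ?_⟩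
    · exact (dif_pos hm).trans hy
    · intro j h
      simp only [dif_pos h, dif_pos (le_refl m), hself]
  have hcl : ∀ m, IsClosed (E m) := fun m => by
    refine IsClosed.inter (isClosed_eq (continuous_apply i) continuous_const) ?_
    simp only [Set.ofPred_forall]
    refine isClosed_iInter fun j => isClosed_iInter fun h => ?_
    exact isClosed_eq ((transition F h).hom.continuous.comp (continuous_apply m.1))
      (continuous_apply j)
  have hdir : Directed (· ⊇ ·) E := fun m m' => by
    obtain ⟨k, hk, hk'⟩ := exists_ge_ge m.1 m'.1
    have key : ∀ (m : Set.Ici i) (hk : m.1 ≤ k), E ⟨k, m.2.trans hk⟩ ⊆ E m :=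
      fun m hk u hu => ⟨hu.1, fun j h => by
        rw [← hu.2 j (h.trans hk), ← hu.2 m.1 hk, hcomp]⟩
    exact ⟨⟨k, m.2.trans hk⟩, key m hk, key m' hk'⟩
  have : Nonempty (Set.Ici i) := ⟨⟨i, le_rfl⟩⟩
  obtain ⟨u, hu⟩ := IsCompact.nonempty_iInter_of_directed_nonempty_isCompact_isClosed E hdir hne
    (fun m => (hcl m).isCompact) hcl
  have hu' : ∀ m, u ∈ E m := Set.mem_iInter.1 hu
  have huF : ∀ {j k : I} (h : j ≤ k), transition F h (u k) = u j := fun {j k} h => by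
    obtain ⟨m, hm, hm'⟩ := exists_ge_ge i k
    rw [← (hu' ⟨m, hm⟩).2 j (h.trans hm'), ← (hu' ⟨m, hm⟩).2 k hm', hcomp]
  let y : (TopCat.limitCone F).pt := ⟨fun j => u j.unop, fun f => huF (leOfHom f.unop)⟩
  refine ⟨(hc.conePointUniqueUpToIso (TopCat.limitConeIsLimit F)).inv y, ?_⟩
  have h := congrArg (fun φ => φ.hom y)
    (hc.conePointUniqueUpToIso_inv_comp (TopCat.limitConeIsLimit F) (op i))
  exact h.trans (hu' ⟨i, le_rfl⟩).1

/-! ### Finite covers and common indices -/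

theorem Cover.exists_finite_subcover {X : TopCat.{u}} [CompactSpace X] {B : OpenBasis X}
    (𝓤 : Cover B ⊤) : ∃ 𝓥 : Cover B ⊤, 𝓥.carrier.Finite ∧ 𝓥.carrier ⊆ 𝓤.carrier := by
  obtain ⟨s, hs⟩ := isCompact_univ.elim_finite_subcover (fun U : 𝓤.carrier => (U.1 : Set X))
    (fun U => U.1.isOpen) fun x _ => by
      obtain ⟨U, hU, hx⟩ := 𝓤.exists_mem (x := x) trivial
      exact Set.mem_iUnion.2 ⟨⟨U, hU⟩, hx⟩
  have hsub : Subtype.val '' (s : Set 𝓤.carrier) ⊆ 𝓤.carrier := by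
    rintro _ ⟨U, -, rfl⟩
    exact U.2
  refine ⟨⟨Subtype.val '' (s : Set 𝓤.carrier), hsub.trans 𝓤.subset, top_le_iff.1 fun x _ => ?_⟩,
    s.finite_toSet.image _, hsub⟩
  obtain ⟨U, hU, hx⟩ := Set.mem_iUnion₂.1 (hs (Set.mem_univ x))
  exact Opens.mem_sSup.2 ⟨U.1, ⟨U, hU, rfl⟩, hx⟩

theorem exists_forall_ge {ι : Type*} [Finite ι] [Nonempty I] [IsDirectedOrder I] (f : ι → I) :
    ∃ k, ∀ a, f a ≤ k := by
  classical
  cases nonempty_fintype ι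
  obtain ⟨k, hk⟩ := (Finset.univ.image f).exists_le
  exact ⟨k, fun a => hk _ (Finset.mem_image_of_mem f (Finset.mem_univ a))⟩

/-- A cover of the limit by members of the standard basis is refined by the preimage of a finite
cover of one of the spaces. -/
theorem exists_finite_cover_refining [IsDirectedOrder I] [Nonempty I] (hc : IsLimit c)
    [CompactSpace c.pt] (hsurj : ∀ i, Function.Surjective (proj c i))
    (𝓤 : Cover (standardBasis hc) ⊤) (i₀ : I) :
    ∃ (j : I) (_ : i₀ ≤ j) (𝓥 : Cover (OpenBasis.all (F.obj (op j))) ⊤)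
      (l : 𝓥.carrier → 𝓤.carrier), 𝓥.carrier.Finite ∧
        ∀ V, (Opens.map (proj c j)).obj V.1 ≤ (l V).1 := by
  obtain ⟨𝓦, hfin, hsub⟩ := 𝓤.exists_finite_subcover
  have : Finite 𝓦.carrier := hfin
  have h₁ : ∀ W : 𝓦.carrier, ∃ (i : I) (U : Opens (F.obj (op i))),
      (Opens.map (proj c i)).obj U = W.1 := fun W => 𝓦.subset W.2
  choose i U hU using h₁
  obtain ⟨k, hk⟩ := exists_forall_ge i
  obtain ⟨j, hij, hkj⟩ := exists_ge_ge i₀ k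
  -- All members of the finite subcover are moved to the common index `j`. The sets `T W` cover
  -- `X_j` because their preimages cover the limit and the projection to `X_j` is surjective.
  let T : 𝓦.carrier → Opens (F.obj (op j)) := fun W =>
    (Opens.map (transition F ((hk W).trans hkj))).obj (U W)
  have hT : ∀ W, (Opens.map (proj c j)).obj (T W) = W.1 := fun W =>
    (preimage_proj c _ _).trans (hU W)
  let 𝓥 : Cover (OpenBasis.all (F.obj (op j))) ⊤ :=
    { carrier := Set.range T
      subset := fun _ _ => trivial
      sSup_eq := top_le_iff.1 fun x _ => by
        obtain ⟨y, rfl⟩ := hsurj j x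
        obtain ⟨W, hW, hy⟩ := 𝓦.exists_mem (x := y) trivial
        exact Opens.mem_sSup.2 ⟨T ⟨W, hW⟩, ⟨_, rfl⟩, (hT ⟨W, hW⟩).ge hy⟩ }
  have h₂ : ∀ V : 𝓥.carrier, ∃ W, T W = V.1 := fun V => V.2
  choose p hp using h₂
  exact ⟨j, hij, 𝓥, fun V => ⟨(p V).1, hsub (p V).2⟩, Set.finite_range T,
    fun V => by rw [← hp V]; exact (hT _).le⟩

instance (i : I) [IsDirectedOrder I] : IsDirectedOrder (Set.Ici i) where
  directed a b := by
    obtain ⟨k, hk, hk'⟩ := exists_ge_ge a.1 b.1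
    exact ⟨⟨k, a.2.trans hk⟩, hk, hk'⟩

end Topology

/-! ## Approximation of a limiting partial presheaf -/

namespace SheafSystem

variable {I : Type u} [Preorder I] {F : Iᵒᵖ ⥤ TopCat.{u}} {S : SheafSystem R F}

theorem pushforwardSystem_map_apply {i : I} {j k : Set.Ici i} (f : j ⟶ k)
    (U : Opens (F.obj (op i))) (x : ((S.pushforwardSystem i).obj j).obj (op U))
    (h : (Opens.map (transition F k.2)).obj U ≤
      (Opens.map (transition F (leOfHom f))).obj ((Opens.map (transition F j.2)).obj U)) :
    ((S.pushforwardSystem i).map f).app (op U) x =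
      (S.hom (leOfHom f)).ev (U := ⟨(Opens.map (transition F j.2)).obj U, trivial⟩)
        (W := ⟨(Opens.map (transition F k.2)).obj U, trivial⟩) h x := by
  change ((S.sheaf k.1).presheaf.map _) _ = ((S.sheaf k.1).presheaf.map _) _
  congr 1

variable {c : Cone F} [IsDirectedOrder I] [Nonempty I] {hc : IsLimit c}

namespace LimitingPartialPresheaf

variable (L : S.LimitingPartialPresheaf hc)

/-- Colimits of presheaves are computed on each open set and filtered colimits of modules on
elements, so every section of `φ_i Γ` comes from some stage. -/
theorem exists_ev_eq (i : I) (U : Opens (F.obj (op i)))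
    (γ : L.presheaf.obj (op ((projPreimage hc i).obj U))) :
    ∃ (j : I) (h : i ≤ j)
      (δ : (S.sheaf j).presheaf.obj (op ((Opens.map (transition F h)).obj U))),
      (L.hom j).ev (U := ⟨_, trivial⟩) (W := (projPreimage hc i).obj U)
        (preimage_proj c h U).ge δ = γ := by
  obtain ⟨hL⟩ := L.isColimit i
  obtain ⟨j, δ, h⟩ := Concrete.isColimit_exists_rep _
    (isColimitOfPreserves ((evaluation _ _).obj (op U)) hL) γ
  exact ⟨j.1, j.2, δ, h⟩

theorem exists_map_eq_zero (i : I) (U : Opens (F.obj (op i)))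
    (g : (S.sheaf i).presheaf.obj (op U)) (hg : (L.map i).app (op U) g = 0) :
    ∃ (j : I) (h : i ≤ j), (S.map h).app (op U) g = 0 := by
  obtain ⟨hL⟩ := L.isColimit i
  have : Nonempty (Set.Ici i) := ⟨⟨i, le_rfl⟩⟩
  let D := (pushforwardSystem S i) ⋙ (evaluation _ _).obj (op U)
  -- The direct system starts with `Γ_i(φ_ii⁻¹(U))`, so `g` is first transported there by `f_ii`;
  -- the end of the proof undoes this with `f_ij f_ii = f_ij`.
  let x : D.obj ⟨i, le_rfl⟩ := (S.map (le_refl i)).app (op U) g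
  let hD := isColimitOfPreserves ((evaluation _ (ModuleCat.{u} R)).obj (op U)) hL
  have hx : (((evaluation _ (ModuleCat.{u} R)).obj (op U)).mapCocone
      (L.toPartialPresheaf.cocone i)).ι.app ⟨i, le_rfl⟩ x = 0 :=
    (congrArg (fun φ => φ.hom g) (L.map_map (le_refl i) U)).trans hg
  obtain ⟨j, a, b, hab⟩ := Concrete.isColimit_exists_of_rep_eq D (i := ⟨i, le_rfl⟩)
    (j := ⟨i, le_rfl⟩) hD x 0 (hx.trans (map_zero (((evaluation _ (ModuleCat.{u} R)).obj
      (op U)).mapCocone (L.toPartialPresheaf.cocone i) |>.ι.app ⟨i, le_rfl⟩).hom).symm)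
  refine ⟨j.1, j.2, ?_⟩
  have h₁ : ((S.pushforwardSystem i).map a).app (op U) x = 0 := hab.trans (map_zero (D.map b).hom)
  have hle : (Opens.map (transition F j.2)).obj U ≤
      (Opens.map (transition F (leOfHom a))).obj
        ((Opens.map (transition F (le_refl i))).obj U) :=
    (preimage_trans F (le_refl i) j.2 U).ge
  rw [pushforwardSystem_map_apply a U x hle] at h₁
  have h₂ := (S.isComp_hom (le_refl i) j.2).ev_eq (U := ⟨U, trivial⟩)
    (V := ⟨(Opens.map (transition F (le_refl i))).obj U, trivial⟩)
    (W := ⟨(Opens.map (transition F j.2)).obj U, trivial⟩) le_rfl hle le_rfl g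
  have h₃ : ∀ {j : I} (h : i ≤ j), (S.hom h).ev (U := ⟨U, trivial⟩)
      (W := ⟨(Opens.map (transition F h)).obj U, trivial⟩) le_rfl g = (S.map h).app (op U) g :=
    fun h => BasisPresheaf.res_self (S.pair _).presheaf le_rfl _
  rw [h₃] at h₂
  exact (h₃ j.2).symm.trans (h₂.symm.trans h₁)

/-- Write `∅` as `φ_i⁻¹(∅)`: every section over it comes from some `Γ_j(∅)`, which is zero since
`Γ_j` is a sheaf. -/
theorem subsingleton_of_eq_bot (V : (standardBasis hc).carrier) (hV : V.1 = ⊥) :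
    Subsingleton (L.presheaf.obj (op V)) := by
  obtain ⟨i⟩ := ‹Nonempty I›
  suffices h : ∀ γ : L.presheaf.obj (op ((projPreimage hc i).obj ⊥)), γ = 0 by
    have : Subsingleton (L.presheaf.obj (op ((projPreimage hc i).obj ⊥))) :=
      ⟨fun a b => (h a).trans (h b).symm⟩
    exact subsingleton_of_eq L.presheaf (V := (projPreimage hc i).obj ⊥) hV.symm
  intro γ
  obtain ⟨j, h, δ, rfl⟩ := L.exists_ev_eq i ⊥ γ
  have hz : IsZero ((S.sheaf j).presheaf.obj (op ⊥)) :=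
    (isZero_zero _).of_iso ((S.sheaf j).isTerminalOfEmpty.uniqueUpToIso
      (isZero_zero (ModuleCat.{u} R)).isTerminal)
  have : Subsingleton ((S.sheaf j).presheaf.obj (op ⊥)) := ModuleCat.subsingleton_of_isZero hz
  have : Subsingleton ((S.sheaf j).presheaf.obj (op ((Opens.map (transition F h)).obj ⊥))) := this
  rw [Subsingleton.elim δ 0]
  exact map_zero ((L.hom j).ev _).hom

/-- The system of the pairs `(X_i, Γ_i)` approximates the limit with the limiting partial
presheaf. -/
def approximatingSystem [CompactSpace c.pt] (hcompact : ∀ i : I, CompactSpace (F.obj (op i)))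
    (hsurj : ∀ i, Function.Surjective (proj c i)) : ApproximatingSystem I L.pair where
  pair := S.pair
  hom := S.hom
  isComp_hom := S.isComp_hom
  proj := L.hom
  isComp_proj := L.isComp_hom
  surjective := hsurj
  exists_lifts i₀ n 𝓤 f := by
    obtain ⟨j, hj, 𝓥, l, hfin, hl⟩ := exists_finite_cover_refining hc hsurj 𝓤 i₀
    have : Finite 𝓥.carrier := hfin
    have hle : ∀ t : Fin (n + 1) → 𝓥.carrier,
        (projPreimage hc j).obj (Cover.inter t).1 ≤ Cover.inter (l ∘ t) := fun t =>
      le_iInf (α := Opens c.pt) fun a => le_trans (fun _ hx => Cover.inter_le t a hx) (hl (t a))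
    -- Each value of the cochain lifts at a stage depending on the tuple `t`. There are finitely
    -- many tuples, so one stage `m'` above all of these and above `j` serves for all, with the
    -- preimage of `𝓥` as cover.
    choose k hk δ hδ using fun t : Fin (n + 1) → 𝓥.carrier =>
      L.exists_ev_eq j (Cover.inter t).1 (L.presheaf.res (hle t) (f (l ∘ t)))
    obtain ⟨m, hm⟩ := exists_forall_ge k
    obtain ⟨m', hmm', hjm'⟩ := exists_ge_ge m j
    obtain ⟨e, he⟩ := exists_preimageCover_section (S.hom hjm') 𝓥
    have hW : ∀ t : Fin (n + 1) → (preimageCover (S.hom hjm') 𝓥).carrier, (Cover.inter t).1 ≤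
        (Opens.map (transition F ((hm (e ∘ t)).trans hmm'))).obj
          ((Opens.map (transition F (hk (e ∘ t)))).obj (Cover.inter (e ∘ t)).1) := fun t =>
      (inter_le_map_inter (S.hom hjm') e (fun V => (he V).ge) t).trans
        (preimage_trans F (hk (e ∘ t)) ((hm (e ∘ t)).trans hmm') _).ge
    refine ⟨m', hj.trans hjm', preimageCover (S.hom hjm') 𝓥, l ∘ e, fun V => ?_,
      fun t => (S.hom ((hm (e ∘ t)).trans hmm')).ev (U := ⟨_, trivial⟩) (hW t) (δ (e ∘ t)), ?_⟩
    · refine le_trans ?_ (hl (e V))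
      rw [← he V]
      exact (preimage_proj c hjm' _).le
    · intro t W hWt hW'
      have hWj : W ≤ (projPreimage hc j).obj (Cover.inter (e ∘ t)).1 :=
        le_trans (α := Opens c.pt) (fun x hx => inter_le_map_inter (S.hom hjm') e
          (fun V => (he V).ge) t (hWt hx)) (preimage_proj c hjm' (Cover.inter (e ∘ t)).1).le
      refine ((L.isComp_hom ((hm (e ∘ t)).trans hmm')).ev_eq
        (U := ⟨(Opens.map (transition F (hk (e ∘ t)))).obj (Cover.inter (e ∘ t)).1, trivial⟩) _ _
        (le_trans (α := Opens c.pt) hWj (preimage_proj c (hk (e ∘ t)) _).ge) _).trans ?_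
      refine ((L.hom _).res_ev (preimage_proj c (hk (e ∘ t)) _).ge hWj _).symm.trans ?_
      exact (congrArg (L.presheaf.res hWj) (hδ (e ∘ t))).trans (L.presheaf.res_res _ _ _)
  exists_pullback_eq_zero i n 𝓤 g hg := by
    have : CompactSpace (S.pair i).space := hcompact i
    -- Passing to a finite subcover of `X_i` leaves finitely many values of `g` to kill, hence a
    -- common stage where all of them vanish.
    obtain ⟨𝓥, hfin, hsub⟩ := 𝓤.exists_finite_subcover
    have : Finite 𝓥.carrier := hfin
    let r : 𝓥.carrier → 𝓤.carrier := fun V => ⟨V.1, hsub V.2⟩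
    choose k hk h0 using fun t : Fin (n + 1) → 𝓥.carrier =>
      L.exists_map_eq_zero i (Cover.inter (r ∘ t)).1 (g (r ∘ t))
        ((L.presheaf.res_self le_rfl _).symm.trans (hg (r ∘ t)
          ((projPreimage hc i).obj (Cover.inter (r ∘ t)).1) le_rfl))
    obtain ⟨m, hm⟩ := exists_forall_ge k
    obtain ⟨m', hmm', him'⟩ := exists_ge_ge m i
    obtain ⟨e, he⟩ := exists_preimageCover_section (S.hom him') 𝓥
    refine ⟨m', him', preimageCover (S.hom him') 𝓥, r ∘ e, fun V => (he V).ge, funext fun t => ?_⟩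
    have hkm := (hm (e ∘ t)).trans hmm'
    have hle := inter_le_map_inter (S.hom him') e (fun V => (he V).ge) t
    refine ((S.isComp_hom (hk (e ∘ t)) hkm).ev_eq
      (V := ⟨(Opens.map (transition F (hk (e ∘ t)))).obj (Cover.inter (r ∘ e ∘ t)).1, trivial⟩)
      le_rfl (hle.trans (preimage_trans F _ hkm _).ge) _ _).symm.trans ?_
    refine (congrArg ((S.hom hkm).ev _) ((BasisPresheaf.res_self (S.pair _).presheaf le_rfl _).trans
      (h0 (e ∘ t)))).trans ?_
    exact map_zero ((S.hom hkm).ev _).hom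

end LimitingPartialPresheaf

end SheafSystem

namespace SheafSystem

variable {I : Type u} [Preorder I] {F : Iᵒᵖ ⥤ TopCat.{u}} (S : SheafSystem R F) {c : Cone F}

/-! ## Existence of a limiting partial presheaf -/

/-- The pairs `(i, U)` with `W ⊆ φ_i⁻¹(U)`. -/
structure Enclosure (c : Cone F) (W : Opens c.pt) where
  index : I
  opens : Opens (F.obj (op index))
  le_map : W ≤ (Opens.map (proj c index)).obj opens

instance (W : Opens c.pt) : Preorder (Enclosure c W) where
  le a b := ∃ h : a.index ≤ b.index, b.opens ≤ (Opens.map (transition F h)).obj a.opens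
  le_refl a := ⟨le_rfl, (preimage_refl F _ _).ge⟩
  le_trans := by
    rintro a b d ⟨h, hU⟩ ⟨h', hU'⟩
    refine ⟨h.trans h', ?_⟩
    rw [← preimage_trans F h h']
    exact fun x hx => hU (hU' hx)

/-- The direct system of the modules `Γ_i(U)`, for `W ⊆ φ_i⁻¹(U)`. -/
def enclosureFunctor (W : Opens c.pt) : Enclosure c W ⥤ ModuleCat.{u} R where
  obj a := (S.sheaf a.index).presheaf.obj (op a.opens)
  map {a b} f := (S.hom (leOfHom f).choose).ev (U := ⟨a.opens, trivial⟩) (W := ⟨b.opens, trivial⟩)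
    (leOfHom f).choose_spec
  map_id a := ModuleCat.hom_ext <| LinearMap.ext fun x => (S.isId_hom a.index).ev_eq _ x
  map_comp f g := ModuleCat.hom_ext <| LinearMap.ext fun x =>
    ((S.isComp_hom (leOfHom f).choose (leOfHom g).choose).ev_eq _ _ _ x).symm

/-- The direct limit of the modules `Γ_i(U)`, for `W ⊆ φ_i⁻¹(U)`. -/
def enclosureColimit (W : Opens c.pt) : ModuleCat.{u} R := colimit (S.enclosureFunctor W)

/-- The canonical map `Γ_i(U) → lim→ Γ_i(U)`. -/
def enclosureι {W : Opens c.pt} (i : I) (U : Opens (F.obj (op i)))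
    (h : W ≤ (Opens.map (proj c i)).obj U) :
    (S.sheaf i).presheaf.obj (op U) ⟶ S.enclosureColimit W :=
  colimit.ι (S.enclosureFunctor W) ⟨i, U, h⟩

theorem enclosure_hom_ext {W : Opens c.pt} {M : ModuleCat.{u} R}
    {f g : S.enclosureColimit W ⟶ M}
    (h : ∀ i U hU, S.enclosureι i U hU ≫ f = S.enclosureι i U hU ≫ g) : f = g :=
  colimit.hom_ext fun a => h a.index a.opens a.le_map

theorem enclosure_w {W : Opens c.pt} {i j : I} (hij : i ≤ j) {U : Opens (F.obj (op i))}
    {V : Opens (F.obj (op j))} (hU : W ≤ (Opens.map (proj c i)).obj U)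
    (hV : W ≤ (Opens.map (proj c j)).obj V) (h : V ≤ (Opens.map (transition F hij)).obj U) :
    (S.hom hij).ev (U := ⟨U, trivial⟩) (W := ⟨V, trivial⟩) h ≫ S.enclosureι j V hV =
      S.enclosureι i U hU :=
  colimit.w (S.enclosureFunctor W) 
    (homOfLE (show (⟨i, U, hU⟩ : Enclosure c W) ≤ ⟨j, V, hV⟩ from ⟨hij, h⟩))

/-- The restriction maps between the direct limits. -/
def enclosureRes {W W' : Opens c.pt} (h : W' ≤ W) :
    S.enclosureColimit W ⟶ S.enclosureColimit W' :=
  colimit.desc (S.enclosureFunctor W)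
    { pt := S.enclosureColimit W'
      ι :=
        { app := fun a => S.enclosureι a.index a.opens (h.trans a.le_map)
          naturality := fun _ _ f =>
            (S.enclosure_w (leOfHom f).choose _ _ (leOfHom f).choose_spec).trans
              (Category.comp_id _).symm } }

theorem enclosureι_res {W W' : Opens c.pt} (h : W' ≤ W) {i : I} {U : Opens (F.obj (op i))}
    (hU : W ≤ (Opens.map (proj c i)).obj U) :
    S.enclosureι i U hU ≫ S.enclosureRes h = S.enclosureι i U (h.trans hU) :=
  colimit.ι_desc _ _

/-- Restriction inside one `Γ_i` is the case `i ≤ i` of the transition maps, because `f_ii` is the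
identity. -/
theorem res_enclosureι {W : Opens c.pt} {i : I} {U V : Opens (F.obj (op i))} (hVU : V ⟶ U)
    (hU : W ≤ (Opens.map (proj c i)).obj U) (hV : W ≤ (Opens.map (proj c i)).obj V) :
    (S.sheaf i).presheaf.map hVU.op ≫ S.enclosureι i V hV = S.enclosureι i U hU := by
  have hV' : V ≤ (Opens.map (transition F (le_refl i))).obj U := by
    rw [preimage_refl]; exact leOfHom hVU
  rw [← S.enclosure_w (le_refl i) hU hV hV']
  refine congrArg (· ≫ S.enclosureι i V hV) (ModuleCat.hom_ext <| LinearMap.ext fun x => ?_)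
  have h₁ := (S.isId_hom i).ev_eq (U := ⟨U, trivial⟩) (preimage_refl F i U).ge x
  refine (congrArg ((S.sheaf i).presheaf.map hVU.op) h₁).symm.trans ?_
  exact (S.hom (le_refl i)).res_ev (U := ⟨U, trivial⟩) (W := ⟨U, trivial⟩) (W' := ⟨V, trivial⟩)
    (preimage_refl F i U).ge (leOfHom hVU) x

/-- The pairs `(j, φ_ij⁻¹(U))` for `j ≥ i`. -/
def iciEnclosure (c : Cone F) (i : I) (U : Opens (F.obj (op i))) :
    Set.Ici i ⥤ Enclosure c ((Opens.map (proj c i)).obj U) where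
  obj j := ⟨j.1, (Opens.map (transition F j.2)).obj U, (preimage_proj c j.2 U).ge⟩
  map {j k} f := homOfLE ⟨leOfHom f, (preimage_trans F j.2 (leOfHom f) U).ge⟩

/-- Given `(a, V)` with `φ_i⁻¹(U) ⊆ φ_a⁻¹(V)`, choose `k` above `i` and `a`. Both sides are
preimages of open sets of `X_k`, and surjectivity of `φ_k` gives `φ_ik⁻¹(U) ⊆ φ_ak⁻¹(V)`. -/
theorem final_iciEnclosure [IsDirectedOrder I] (hsurj : ∀ i, Function.Surjective (proj c i)) (i : I)
    (U : Opens (F.obj (op i))) : (iciEnclosure c i U).Final := by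
  refine Functor.final_of_exists_of_isFiltered _ (fun a => ?_)
    fun {_ j} _ _ => ⟨j, 𝟙 _, Subsingleton.elim _ _⟩
  obtain ⟨k, hik, hak⟩ := exists_ge_ge i a.index
  refine ⟨⟨k, hik⟩, ⟨homOfLE ⟨hak, fun x hx => ?_⟩⟩⟩
  obtain ⟨y, rfl⟩ := hsurj k x
  have h₁ : y ∈ (Opens.map (proj c i)).obj U := (preimage_proj c hik U).le hx
  exact (preimage_proj c hak a.opens).ge (a.le_map h₁)

variable [IsDirectedOrder I] [Nonempty I]

/-- The presheaf `W ↦ lim→ Γ_i(U)`, for `W ⊆ φ_i⁻¹(U)`, on the standard basis. -/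
def enclosurePresheaf (hc : IsLimit c) : BasisPresheaf R (standardBasis hc) where
  obj W := S.enclosureColimit W.unop.1
  map f := S.enclosureRes (leOfHom f.unop)
  map_id W := S.enclosure_hom_ext fun i U hU =>
    (S.enclosureι_res _ hU).trans (Category.comp_id _).symm
  map_comp f g := S.enclosure_hom_ext fun i U hU => by
    rw [enclosureι_res, ← Category.assoc, enclosureι_res, enclosureι_res]

/-- The direct limits of the modules `Γ_i(U)` as a partial presheaf. -/
def enclosurePartialPresheaf (hc : IsLimit c) : S.PartialPresheaf hc where
  presheaf := S.enclosurePresheaf hc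
  map i :=
    { app := fun U => S.enclosureι i U.unop le_rfl
      naturality := fun U V f => by
        have hVU : (Opens.map (proj c i)).obj V.unop ≤ (Opens.map (proj c i)).obj U.unop :=
          ((Opens.map (proj c i)).map f.unop).le
        exact (S.res_enclosureι f.unop hVU le_rfl).trans (S.enclosureι_res hVU le_rfl).symm }
  map_map {i j} h U := by
    have hle := (preimage_proj c h U).ge
    refine (congrArg (_ ≫ ·) (S.enclosureι_res hle le_rfl)).trans ?_
    refine Eq.trans (congrArg (· ≫ S.enclosureι j _ hle) ?_)
      (S.enclosure_w h (V := (Opens.map (transition F h)).obj U) le_rfl hle le_rfl)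
    exact ModuleCat.hom_ext <| LinearMap.ext fun x =>
      (BasisPresheaf.res_self (S.pair j).presheaf (U := ⟨(Opens.map (transition F h)).obj U, trivial⟩)
        le_rfl ((S.map h).app (op U) x)).symm

theorem nonempty_limitingPartialPresheaf (hc : IsLimit c)
    (hsurj : ∀ i, Function.Surjective (proj c i)) : Nonempty (S.LimitingPartialPresheaf hc) := by
  refine ⟨{ S.enclosurePartialPresheaf hc with isColimit := fun i => ⟨?_⟩ }⟩
  -- On each `U`, finality turns the defining colimit over all enclosures of `φ_i⁻¹(U)` into one
  -- over `j ≥ i`; `α` and `w` identify the latter with the system `φ_ij Γ_j` and its cocone.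
  refine evaluationJointlyReflectsColimits _ fun U => ?_
  have := final_iciEnclosure hsurj i U.unop
  have hcol := (Functor.Final.isColimitWhiskerEquiv (iciEnclosure c i U.unop) _).symm
    (colimit.isColimit (S.enclosureFunctor ((Opens.map (proj c i)).obj U.unop)))
  let α : iciEnclosure c i U.unop ⋙ S.enclosureFunctor ((Opens.map (proj c i)).obj U.unop) ≅
      S.pushforwardSystem i ⋙ (evaluation _ _).obj U :=
    NatIso.ofComponents (fun j => Iso.refl _) fun {j k} f => by
      refine (Category.comp_id _).trans (Eq.trans ?_ (Category.id_comp _).symm)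
      exact ModuleCat.hom_ext <| LinearMap.ext fun x =>
        (pushforwardSystem_map_apply f U.unop x _).symm
  let d := ((evaluation _ (ModuleCat.{u} R)).obj U).mapCocone
    ((S.enclosurePartialPresheaf hc).cocone i)
  let w : (Cocone.precompose α.inv).obj (Cocone.whisker (iciEnclosure c i U.unop)
      (colimit.cocone (S.enclosureFunctor ((Opens.map (proj c i)).obj U.unop)))) ≅ d :=
    Cocone.ext (Iso.refl (S.enclosureColimit ((Opens.map (proj c i)).obj U.unop))) fun j =>
      (Category.comp_id _).trans ((Category.id_comp _).trans
        (S.enclosureι_res (preimage_proj c j.2 U.unop).ge le_rfl).symm)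
  exact IsColimit.equivOfNatIsoOfIso α _ d w hcol

/-! ### The continuity isomorphism -/

namespace LimitingPartialPresheaf

variable {S} {hc : IsLimit c} (L : S.LimitingPartialPresheaf hc)

theorem ι_continuityMap (n : ℕ) (i : I) (y : cechCohomology (S.pair i) n) :
    L.continuityMap n (colimit.ι (S.cohomologySystem n) i y) =
      toSheafificationMap L.pair n (cechCohomologyMap (L.hom i) n y) :=
  congrArg (fun φ => φ.hom y) (colimit.ι_desc (L.cohomologyCocone n) i)

/-- The map factors through the cohomology of `Γ` on the standard basis: the criterion handles the
passage from the stages to `Γ`, and `isIso_toSheafificationMap` the passage from `Γ` to its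
sheafification. -/
theorem isIso_continuityMap [CompactSpace c.pt] [T2Space c.pt]
    (hcompact : ∀ i : I, CompactSpace (F.obj (op i)))
    (hsurj : ∀ i, Function.Surjective (proj c i)) (n : ℕ) : IsIso (L.continuityMap n) := by
  let A := L.approximatingSystem hcompact hsurj
  have : CompactSpace L.pair.space := ‹CompactSpace c.pt›
  have : T2Space L.pair.space := ‹T2Space c.pt›
  have hs := (ConcreteCategory.isIso_iff_bijective _).1
    (isIso_toSheafificationMap L.pair L.subsingleton_of_eq_bot n)
  rw [ConcreteCategory.isIso_iff_bijective]
  constructor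
  · refine (injective_iff_map_eq_zero (L.continuityMap n).hom).2 fun x hx => ?_
    obtain ⟨i, y, rfl⟩ := Concrete.colimit_exists_rep (S.cohomologySystem n) x
    have h₁ : toSheafificationMap L.pair n (cechCohomologyMap (L.hom i) n y) = 0 :=
      (L.ι_continuityMap n i y).symm.trans hx
    have h₂ := (injective_iff_map_eq_zero (toSheafificationMap L.pair n).hom).1 hs.1 _ h₁
    obtain ⟨j, h, h₃⟩ := A.exists_map_hom_eq_zero n i y h₂
    have h₄ := congrArg (fun φ => φ.hom y) (colimit.w (S.cohomologySystem n) (homOfLE h))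
    refine h₄.symm.trans ?_
    exact (congrArg (colimit.ι (S.cohomologySystem n) j).hom h₃).trans (map_zero _)
  · intro x
    obtain ⟨z, rfl⟩ := hs.2 x
    obtain ⟨i, y, rfl⟩ := A.exists_map_proj_eq n z
    exact ⟨_, L.ι_continuityMap n i y⟩

end LimitingPartialPresheaf

end SheafSystem

end CechContinuity

theorem mainTheorem2 {R : Type v} [Ring R] {I : Type u} [Preorder I] [IsDirectedOrder I]
    [Nonempty I] (F : Iᵒᵖ ⥤ TopCat.{u})
    (hcompact : ∀ i : I, CompactSpace (F.obj (op i))) (hT2 : ∀ i : I, T2Space (F.obj (op i)))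
    (hsurj : ∀ {i j : I} (h : i ≤ j), Function.Surjective (CechContinuity.transition F h))
    (c : Cone F) (hc : IsLimit c) (S : CechContinuity.SheafSystem R F) :
    Nonempty (S.LimitingPartialPresheaf hc) ∧
      ∀ (L : S.LimitingPartialPresheaf hc) (n : ℕ), IsIso (L.continuityMap n) := by
  have hproj := CechContinuity.surjective_proj hc hcompact hT2 hsurj
  refine ⟨S.nonempty_limitingPartialPresheaf hc hproj, fun L n => ?_⟩
  have : CompactSpace c.pt := CechContinuity.compactSpace_pt hc hcompact hT2
  have : T2Space c.pt := CechContinuity.t2Space_pt hc hT2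
  exact L.isIso_continuityMap hcompact hproj n

end
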